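/- Call a partial function $\psi:\subseteq\mathbb N\to\mathbb N$ *pdominating* for a partial function $\varphi:\subseteq\mathbb N\to\mathbb N$ if for all but finitely many $x\in\mathrm{dom}(\varphi)$ there is a $y\in\mathrm{dom}(\psi)$ with $y\le x$ and $\psi(y)>\varphi(x)$. A set $A\subseteq\mathbb N$ is *pdominant* if there is a partial $A$-recursive function that is pdominating for every partial recursive function. A set $A\subseteq\mathbb N$ is *high* if $K'\le_T A'$, where $K$ is the halting problem, $X'$ denotes the Turing jump of $X$, and $\le_T$ is Turing reducibility. **Theorem.** There is a recursively enumerable set $A\subseteq\mathbb N$ which is high and not pdominant. -/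

import Mathlib

/-- Programs with access to one total oracle `ℕ → ℕ`.  These are the programs
`Nat.Partrec.Code` of Mathlib together with one more instruction, `oracle`. -/
inductive OracleCode : Type
  | zero : OracleCode
  | succ : OracleCode
  | left : OracleCode
  | right : OracleCode
  | oracle : OracleCode
  | pair : OracleCode → OracleCode → OracleCode
  | comp : OracleCode → OracleCode → OracleCode
  | prec : OracleCode → OracleCode → OracleCode
  | rfind' : OracleCode → OracleCode

namespace OracleCode

/-- The partial function computed by a program with oracle `g`.  The clauses are those of
`Nat.Partrec.Code.eval`; the instruction `oracle` returns the value of `g`. -/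
def eval (g : ℕ → ℕ) : OracleCode → ℕ →. ℕ
  | zero => pure 0
  | succ => Nat.succ
  | left => ↑fun n : ℕ => n.unpair.1
  | right => ↑fun n : ℕ => n.unpair.2
  | oracle => ↑g
  | pair cf cg => fun n => Nat.pair <$> eval g cf n <*> eval g cg n
  | comp cf cg => fun n => eval g cg n >>= eval g cf
  | prec cf cg =>
    Nat.unpaired fun a n =>
      n.rec (eval g cf a) fun y IH => do
        let i ← IH
        eval g cg (Nat.pair a (Nat.pair y i))
  | rfind' cf =>
    Nat.unpaired fun a m =>
      (Nat.rfind fun n => (fun m => m = 0) <$> eval g cf (Nat.pair a (n + m))).map (· + m)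

/-- The Gödel number of a program. -/
def encodeCode : OracleCode → ℕ
  | zero => 0
  | succ => 1
  | left => 2
  | right => 3
  | oracle => 4
  | pair cf cg => 2 * (2 * Nat.pair (encodeCode cf) (encodeCode cg)) + 5
  | comp cf cg => 2 * (2 * Nat.pair (encodeCode cf) (encodeCode cg) + 1) + 5
  | prec cf cg => (2 * (2 * Nat.pair (encodeCode cf) (encodeCode cg)) + 1) + 5
  | rfind' cf => (2 * (2 * encodeCode cf + 1) + 1) + 5

/-- The program with a given Gödel number. -/
def ofNatCode : ℕ → OracleCode
  | 0 => zero
  | 1 => succ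
  | 2 => left
  | 3 => right
  | 4 => oracle
  | n + 5 =>
    let m := n.div2.div2
    have hm : m < n + 5 := by
      simp only [m, Nat.div2_val]
      exact
        lt_of_le_of_lt (le_trans (Nat.div_le_self _ _) (Nat.div_le_self _ _))
          (Nat.succ_le_succ (Nat.le_add_right _ _))
    have _m1 : m.unpair.1 < n + 5 := lt_of_le_of_lt m.unpair_left_le hm
    have _m2 : m.unpair.2 < n + 5 := lt_of_le_of_lt m.unpair_right_le hm
    match n.bodd, n.div2.bodd with
    | false, false => pair (ofNatCode m.unpair.1) (ofNatCode m.unpair.2)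
    | false, true => comp (ofNatCode m.unpair.1) (ofNatCode m.unpair.2)
    | true, false => prec (ofNatCode m.unpair.1) (ofNatCode m.unpair.2)
    | true, true => rfind' (ofNatCode m)
  termination_by n => n
  decreasing_by all_goals first | exact hm | exact _m1 | exact _m2

theorem ofNatCode_encodeCode (c : OracleCode) : ofNatCode (encodeCode c) = c := by
  induction c <;> simp [encodeCode, ofNatCode, Nat.div2_val, *]

theorem encodeCode_ofNatCode : ∀ n, encodeCode (ofNatCode n) = n
  | 0 => by simp [ofNatCode, encodeCode]
  | 1 => by simp [ofNatCode, encodeCode]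
  | 2 => by simp [ofNatCode, encodeCode]
  | 3 => by simp [ofNatCode, encodeCode]
  | 4 => by simp [ofNatCode, encodeCode]
  | n + 5 => by
    let m := n.div2.div2
    have hm : m < n + 5 := by
      simp only [m, Nat.div2_val]
      exact
        lt_of_le_of_lt (le_trans (Nat.div_le_self _ _) (Nat.div_le_self _ _))
          (Nat.succ_le_succ (Nat.le_add_right _ _))
    have _m1 : m.unpair.1 < n + 5 := lt_of_le_of_lt m.unpair_left_le hm
    have _m2 : m.unpair.2 < n + 5 := lt_of_le_of_lt m.unpair_right_le hm
    have IH := encodeCode_ofNatCode m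
    have IH1 := encodeCode_ofNatCode m.unpair.1
    have IH2 := encodeCode_ofNatCode m.unpair.2
    conv_rhs => rw [← Nat.bit_bodd_div2 n, ← Nat.bit_bodd_div2 n.div2]
    simp only [ofNatCode.eq_6]
    cases n.bodd <;> cases n.div2.bodd <;>
      simp [m, encodeCode, IH, IH1, IH2, Nat.bit_val]
  termination_by n => n
  decreasing_by all_goals first | exact hm | exact _m1 | exact _m2

/-- The Gödel numbering is a bijection between programs and natural numbers. -/
instance instDenumerable : Denumerable OracleCode :=
  Denumerable.mk' ⟨encodeCode, ofNatCode, ofNatCode_encodeCode, encodeCode_ofNatCode⟩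

/-- The programs compute exactly the partial functions that are recursive in the oracle, in the
sense of Mathlib. -/
theorem exists_code {g : ℕ → ℕ} {f : ℕ →. ℕ} :
    Nat.RecursiveIn {(↑g : ℕ →. ℕ)} f ↔ ∃ c : OracleCode, eval g c = f := by
  refine ⟨fun h => ?_, ?_⟩
  · induction h with
    | zero => exact ⟨zero, rfl⟩
    | succ => exact ⟨succ, rfl⟩
    | left => exact ⟨left, rfl⟩
    | right => exact ⟨right, rfl⟩
    | oracle h hh => exact ⟨oracle, by rw [Set.mem_singleton_iff.1 hh]; rfl⟩
    | pair pf pg hf hg =>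
      rcases hf with ⟨cf, rfl⟩; rcases hg with ⟨cg, rfl⟩
      exact ⟨pair cf cg, rfl⟩
    | comp pf pg hf hg =>
      rcases hf with ⟨cf, rfl⟩; rcases hg with ⟨cg, rfl⟩
      exact ⟨comp cf cg, rfl⟩
    | prec pf pg hf hg =>
      rcases hf with ⟨cf, rfl⟩; rcases hg with ⟨cg, rfl⟩
      exact ⟨prec cf cg, rfl⟩
    | rfind pf hf =>
      rcases hf with ⟨cf, rfl⟩
      refine ⟨comp (rfind' cf) (pair (pair left right) zero), ?_⟩
      simp [eval, Seq.seq, pure, PFun.pure, Part.map_id']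
      rfl
  · rintro ⟨c, rfl⟩
    induction c with
    | zero => exact Nat.RecursiveIn.zero
    | succ => exact Nat.RecursiveIn.succ
    | left => exact Nat.RecursiveIn.left
    | right => exact Nat.RecursiveIn.right
    | oracle => exact Nat.RecursiveIn.oracle _ rfl
    | pair cf cg pf pg => exact pf.pair pg
    | comp cf cg pf pg => exact pf.comp pg
    | prec cf cg pf pg => exact pf.prec pg
    | rfind' cf pf =>
      have h1 : Nat.Primrec fun p : ℕ =>
          Nat.pair p.unpair.1.unpair.1 (p.unpair.2 + p.unpair.1.unpair.2) :=
        Primrec.nat_iff.1 <| Primrec₂.natPair.comp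
          (Primrec.fst.comp <| Primrec.unpair.comp <| Primrec.fst.comp Primrec.unpair)
          (Primrec.nat_add.comp (Primrec.snd.comp Primrec.unpair)
            (Primrec.snd.comp <| Primrec.unpair.comp <| Primrec.fst.comp Primrec.unpair))
      have h2 : Nat.Primrec fun p : ℕ => p.unpair.1 + p.unpair.2 :=
        Primrec.nat_iff.1 <| Primrec.nat_add.comp (Primrec.fst.comp Primrec.unpair)
          (Primrec.snd.comp Primrec.unpair)
      refine (((Nat.Primrec.recursiveIn h2).comp (((pf.comp
        (Nat.Primrec.recursiveIn h1)).rfind).pair Nat.RecursiveIn.right))).of_eq fun n => ?_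
      simp [eval, Seq.seq, Nat.unpaired, Part.bind_some_eq_map, Part.map_map, Function.comp_def]
      congr 1
      congr 1
      funext k
      congr 1
      exact Part.bind_some _ _

end OracleCode

open Classical in
/-- The characteristic function of a set of natural numbers. -/
noncomputable def charFn (A : Set ℕ) (n : ℕ) : ℕ := if n ∈ A then 1 else 0

/-- The partial function `ψ` is partial `A`-recursive. -/
def PartialRecursiveInSet (A : Set ℕ) (ψ : ℕ →. ℕ) : Prop :=
  Nat.RecursiveIn {(↑(charFn A) : ℕ →. ℕ)} ψ

/-- Turing reducibility of sets, `B ≤_T A`: the characteristic function of `B` is recursive in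
that of `A`. -/
def SetTuringReducible (B A : Set ℕ) : Prop :=
  TuringReducible (↑(charFn B) : ℕ →. ℕ) (↑(charFn A) : ℕ →. ℕ)

/-- The Turing jump `A'`: the set of all `e` such that the `e`-th program with oracle `A` halts
on input `e`. -/
def turingJump (A : Set ℕ) : Set ℕ :=
  {e | (OracleCode.eval (charFn A) (Denumerable.ofNat OracleCode e) e).Dom}

/-- The halting problem `K`, as the jump of the empty set. -/
def haltingSet : Set ℕ := turingJump ∅

/-- `A` is high: its jump computes the jump `K'` of the halting problem. -/
def IsHigh (A : Set ℕ) : Prop := SetTuringReducible (turingJump haltingSet) (turingJump A)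

/-- `A` is recursively enumerable. -/
def IsRE (A : Set ℕ) : Prop := REPred fun n => n ∈ A

/-- `ψ` pdominates `φ`: for all but finitely many `x` in the domain of `φ` there is some `y ≤ x`
in the domain of `ψ` with `ψ(y) > φ(x)`. -/
def PDominates (ψ φ : ℕ →. ℕ) : Prop :=
  {x | ∃ hx : (φ x).Dom, ¬ ∃ y, ∃ hy : (ψ y).Dom, y ≤ x ∧ (φ x).get hx < (ψ y).get hy}.Finite

/-- `A` is pdominant: some partial `A`-recursive function pdominates every partial recursive
function. -/
def IsPDominant (A : Set ℕ) : Prop :=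
  ∃ ψ : ℕ →. ℕ, PartialRecursiveInSet A ψ ∧ ∀ φ : ℕ →. ℕ, Nat.Partrec φ → PDominates ψ φ

/-!
The set is built stage by stage on a tree of guesses at the jump `K'` of the halting problem. Since
`K'` is recursively enumerable in `K`, there is a primitive recursive sequence of guesses
`stageGuess s` such that every element of `K'` belongs to almost all of them, while for every `l`
infinitely many of them are right on the first `l` bits (`eventually_truePath_le`,
`frequently_pathNum_eq`). The first `l` bits of the guess at stage `s` are coded as a number
`pathNum s l`, so that "to the left of" is `<` between such numbers.

*Highness.* At every stage `t`, a marker `Nat.pair j t + 2` is appointed for every `j`. It is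
enumerated as soon as the first `j + 1` bits of the guess move to the left of those at stage `t`,
unless a requirement has frozen it. If nothing were frozen, then a stage `s` whose guess is right
on the first `i + 1` bits could be recognised by universal questions about the set: no later guess
goes to the left, and the markers of all later guesses to the right are enumerated. The requirements
freeze only finitely many markers that matter here, so a late enough such stage still works for
every `i` outside `K'`, while no stage `s` that passes the test is wrong (`exists_refutes`,
`Refutes.notMem`). Elements of `K'` are recognised by the constant guess. Universal questions about
`A` are answered by the jump of `A`, whence `A` is high (`setTuringReducible_turingJump`).

*Failure of pdomination.* A requirement with index `m` belongs to a node of the tree and to an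
opponent, a program with oracle `A`. It looks for an argument `y < 2 ^ (m + 1)` on which the
opponent has a value that is not smaller than the stages of all previous attacks, and then attacks
with `y`: the markers for bits at or below the node that were appointed while the guess passed
through it are frozen, which preserves the computation if the node is on the true path
(`mem_setStage_iff_of_attack`). In that case the values seen are true, so the arguments of the
attacks are distinct, there are finitely many attacks, and the stage of the last one exceeds every
value of the opponent below `2 ^ (m + 1)` (`exists_length_attackArgs_le`, `lt_of_length_attackArgs`). It remains to find a partial recursive
function which at some `x` with `2 ^ m ≤ x < 2 ^ (m + 1)` waits for the last attack. The number `N`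
of attacks may be anything up to `2 ^ (m + 1)`, which is more than the block of `m` can code, so two
functions share the task: one takes `x = 2 ^ m + i` as the claim that there are `i + 1` attacks,
which covers `N ≤ 2 ^ m`; the other is defined only on arguments `x` of attacks, and takes the
one in position `i` (counted from `0`) among those in the block as the claim that there are
`2 ^ m + i + 1` attacks (`exists_counts`). As every opponent occurs in infinitely many blocks, it fails to pdominate one of
the two functions. An opponent without values fails for the zero function.
-/

namespace OracleCode

open Filter
open Nat.Partrec (Code)

/-! ### Programs with partial oracles -/

/-- The partial function computed by a program whose oracle is itself a partial function. -/
def evalP (g : ℕ →. ℕ) : OracleCode → ℕ →. ℕ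
  | zero => pure 0
  | succ => Nat.succ
  | left => ↑fun n : ℕ => n.unpair.1
  | right => ↑fun n : ℕ => n.unpair.2
  | oracle => g
  | pair cf cg => fun n => Nat.pair <$> evalP g cf n <*> evalP g cg n
  | comp cf cg => fun n => evalP g cg n >>= evalP g cf
  | prec cf cg =>
    Nat.unpaired fun a n =>
      n.rec (evalP g cf a) fun y IH => do
        let i ← IH
        evalP g cg (Nat.pair a (Nat.pair y i))
  | rfind' cf =>
    Nat.unpaired fun a m =>
      (Nat.rfind fun n => (fun m => m = 0) <$> evalP g cf (Nat.pair a (n + m))).map (· + m)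

theorem evalP_coe (g : ℕ → ℕ) (c : OracleCode) : evalP (↑g) c = eval g c := by
  induction c with
  | zero | succ | left | right | oracle => rfl
  | pair cf cg hf hg => simp only [evalP, eval, hf, hg]; rfl
  | comp cf cg hf hg => simp only [evalP, eval, hf, hg]; rfl
  | prec cf cg hf hg => simp only [evalP, eval, hf, hg]; rfl
  | rfind' cf hf => simp only [evalP, eval, hf]; rfl

theorem evalP_pair (g : ℕ →. ℕ) (cf cg : OracleCode) (n : ℕ) :
    evalP g (pair cf cg) n =
      (evalP g cf n).bind fun a => (evalP g cg n).bind fun b => Part.some (Nat.pair a b) := by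
  simp [evalP, Seq.seq, Part.bind_some_eq_map]

theorem evalP_comp (g : ℕ →. ℕ) (cf cg : OracleCode) (n : ℕ) :
    evalP g (comp cf cg) n = (evalP g cg n).bind fun a => evalP g cf a := rfl

theorem evalP_prec_zero (g : ℕ →. ℕ) (cf cg : OracleCode) (x : ℕ) :
    evalP g (prec cf cg) (Nat.pair x 0) = evalP g cf x := by
  simp [evalP]

theorem evalP_prec_succ (g : ℕ →. ℕ) (cf cg : OracleCode) (x k : ℕ) :
    evalP g (prec cf cg) (Nat.pair x (k + 1)) =
      (evalP g (prec cf cg) (Nat.pair x k)).bind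
        fun i => evalP g cg (Nat.pair x (Nat.pair k i)) := by
  simp [evalP]

theorem evalP_rfind' (g : ℕ →. ℕ) (cf : OracleCode) (x k : ℕ) :
    evalP g (rfind' cf) (Nat.pair x k) =
      (Nat.rfind fun n => (evalP g cf (Nat.pair x (n + k))).map fun m => decide (m = 0)).map
        (· + k) := by
  simp [evalP]

theorem code_eval_comp (cf cg : Code) (n : ℕ) :
    (Code.comp cf cg).eval n = (cg.eval n).bind fun a => cf.eval a := rfl

theorem code_eval_pair (cf cg : Code) (n : ℕ) : (Code.pair cf cg).eval n =
    (cf.eval n).bind fun a => (cg.eval n).bind fun b => Part.some (Nat.pair a b) := by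
  simp [Code.eval, Seq.seq, Part.bind_some_eq_map]

theorem code_eval_left (n : ℕ) : Code.left.eval n = Part.some n.unpair.1 := rfl

theorem code_eval_right (n : ℕ) : Code.right.eval n = Part.some n.unpair.2 := rfl

theorem code_eval_rfind' (cf : Code) (x k : ℕ) :
    (Code.rfind' cf).eval (Nat.pair x k) =
      (Nat.rfind fun n => (cf.eval (Nat.pair x (n + k))).map fun m => decide (m = 0)).map
        (· + k) := by
  simp [Code.eval]

/-- Use principle: a convergent computation only depends on a finite part of its oracle. -/
theorem eventually_evalP {g : ℕ →. ℕ} (c : OracleCode) : ∀ {n v : ℕ}, v ∈ evalP g c n →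
    ∀ᶠ ℓ in atTop, ∀ g' : ℕ →. ℕ, (∀ k < ℓ, ∀ w ∈ g k, w ∈ g' k) → v ∈ evalP g' c n := by
  induction c with
  | zero => intro n v h; exact .of_forall fun _ _ _ => h
  | succ => intro n v h; exact .of_forall fun _ _ _ => h
  | left => intro n v h; exact .of_forall fun _ _ _ => h
  | right => intro n v h; exact .of_forall fun _ _ _ => h
  | oracle =>
    intro n v h
    filter_upwards [eventually_gt_atTop n] with ℓ hℓ g' hg'
    exact hg' n hℓ v h
  | pair cf cg hf hg =>
    intro n v h
    simp only [evalP_pair, Part.mem_bind_iff] at h ⊢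
    obtain ⟨a, ha, b, hb, hv⟩ := h
    filter_upwards [hf ha, hg hb] with ℓ h1 h2 g' hg'
    exact ⟨a, h1 g' hg', b, h2 g' hg', hv⟩
  | comp cf cg hf hg =>
    intro n v h
    simp only [evalP_comp, Part.mem_bind_iff] at h ⊢
    obtain ⟨a, ha, hv⟩ := h
    filter_upwards [hg ha, hf hv] with ℓ h1 h2 g' hg'
    exact ⟨a, h1 g' hg', h2 g' hg'⟩
  | prec cf cg hf hg =>
    intro n
    obtain ⟨x, k, rfl⟩ : ∃ x k, n = Nat.pair x k := ⟨_, _, (Nat.pair_unpair n).symm⟩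
    induction k with
    | zero => intro v h; simp only [evalP_prec_zero] at h ⊢; exact hf h
    | succ k ih =>
      intro v h
      simp only [evalP_prec_succ, Part.mem_bind_iff] at h ⊢
      obtain ⟨i, hi, hv⟩ := h
      filter_upwards [ih hi, hg hv] with ℓ h1 h2 g' hg'
      exact ⟨i, h1 g' hg', h2 g' hg'⟩
  | rfind' cf hf =>
    intro n v h
    obtain ⟨x, m, rfl⟩ : ∃ x m, n = Nat.pair x m := ⟨_, _, (Nat.pair_unpair n).symm⟩
    simp only [evalP_rfind', Part.mem_map_iff] at h ⊢
    obtain ⟨k, hk, rfl⟩ := h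
    obtain ⟨hw, hlt⟩ := Nat.mem_rfind.1 hk
    obtain ⟨w, hw, hw0⟩ := (Part.mem_map_iff _).1 hw
    have h2 : ∀ᶠ ℓ in atTop, ∀ i ∈ Set.Iio k, ∀ g' : ℕ →. ℕ,
        (∀ k < ℓ, ∀ w ∈ g k, w ∈ g' k) →
        ∃ a ∈ evalP g' cf (Nat.pair x (i + m)), decide (a = 0) = false := by
      rw [Filter.eventually_all_finite (Set.finite_Iio k)]
      intro i hi
      obtain ⟨a, ha, ha0⟩ := (Part.mem_map_iff _).1 (hlt hi)
      filter_upwards [hf ha] with ℓ h1 g' hg'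
      exact ⟨a, h1 g' hg', ha0⟩
    filter_upwards [hf hw, h2] with ℓ h1 h2 g' hg'
    exact ⟨k, Nat.mem_rfind.2 ⟨(Part.mem_map_iff _).2 ⟨w, h1 g' hg', hw0⟩,
      fun {i} hi => (Part.mem_map_iff _).2 (h2 i hi g' hg')⟩, rfl⟩

theorem evalP_mono {g g' : ℕ →. ℕ} (hg : ∀ k, ∀ w ∈ g k, w ∈ g' k) {c : OracleCode} {n v : ℕ}
    (h : v ∈ evalP g c n) : v ∈ evalP g' c n := by
  obtain ⟨ℓ, hℓ⟩ := (eventually_evalP c h).exists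
  exact hℓ g' fun k _ => hg k

/-! ### Translation to programs without oracle -/

/-- A finite string, as a partial oracle that answers the queries below its length. -/
def strOracle (L : List ℕ) : ℕ →. ℕ := fun k => (L[k]? : Option ℕ)

theorem mem_strOracle {L : List ℕ} {k w : ℕ} : w ∈ strOracle L k ↔ L[k]? = some w := by
  simp [strOracle]

theorem exists_lookup : ∃ c : Code, ∀ L k,
    c.eval (Nat.pair (Encodable.encode (L : List ℕ)) k) = strOracle L k := by
  have h : Partrec fun p : ℕ => (((Denumerable.ofNat (List ℕ) p.unpair.1)[p.unpair.2]? : Option ℕ) :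
      Part ℕ) := by
    apply Computable.ofOption
    exact (Primrec.list_getElem?.comp ((Primrec.ofNat (List ℕ)).comp
      (Primrec.fst.comp Primrec.unpair)) (Primrec.snd.comp Primrec.unpair)).to_comp
  obtain ⟨c, hc⟩ := Code.exists_code.1 (Partrec.nat_iff.1 h)
  exact ⟨c, fun L k => by rw [hc]; simp [strOracle]⟩

/-- A program without oracle which reads off the entries of a string given as part of the input. -/
noncomputable def lookup : Code := exists_lookup.choose

/-- The map `⟨⟨a, x⟩, w⟩ ↦ ⟨a, ⟨x, w⟩⟩`. -/
def assoc : Code := .pair (.comp .left .left) (.pair (.comp .right .left) .right)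

/-- The map `⟨a, ⟨x, w⟩⟩ ↦ ⟨⟨a, x⟩, w⟩`. -/
def assocInv : Code := .pair (.pair .left (.comp .left .right)) (.comp .right .right)

theorem eval_assoc (a x w : ℕ) :
    assoc.eval (Nat.pair (Nat.pair a x) w) = Part.some (Nat.pair a (Nat.pair x w)) := by
  simp [assoc, code_eval_pair, code_eval_comp, code_eval_left, code_eval_right]

theorem eval_assocInv (a x w : ℕ) :
    assocInv.eval (Nat.pair a (Nat.pair x w)) = Part.some (Nat.pair (Nat.pair a x) w) := by
  simp [assocInv, code_eval_pair, code_eval_comp, code_eval_left, code_eval_right]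

/-- Translation of a program with oracle to a program without oracle, which finds the relevant
finite part of the oracle in the first component of its input. -/
noncomputable def tr : OracleCode → Code
  | zero => .zero
  | succ => .comp .succ .right
  | left => .comp .left .right
  | right => .comp .right .right
  | oracle => lookup
  | pair cf cg => .pair (tr cf) (tr cg)
  | comp cf cg => .comp (tr cf) (.pair .left (tr cg))
  | prec cf cg => .comp (.prec (tr cf) (.comp (tr cg) assoc)) assocInv
  | rfind' cf => .comp (.rfind' (.comp (tr cf) assoc)) assocInv

theorem eval_tr (L : List ℕ) (c : OracleCode) :
    ∀ n, (tr c).eval (Nat.pair (Encodable.encode L) n) = evalP (strOracle L) c n := by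
  induction c with
  | zero => intro n; rfl
  | succ =>
    intro n
    simp only [tr, code_eval_comp, code_eval_right, Nat.unpair_pair, Part.bind_some]
    rfl
  | left =>
    intro n
    simp only [tr, code_eval_comp, code_eval_right, Nat.unpair_pair, Part.bind_some]
    rfl
  | right =>
    intro n
    simp only [tr, code_eval_comp, code_eval_right, Nat.unpair_pair, Part.bind_some]
    rfl
  | oracle => intro n; exact exists_lookup.choose_spec L n
  | pair cf cg hf hg => intro n; simp only [tr, code_eval_pair, evalP_pair, hf, hg]
  | comp cf cg hf hg =>
    intro n
    simp only [tr, code_eval_comp, code_eval_pair, code_eval_left, Nat.unpair_pair, hg,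
      Part.bind_some, Part.bind_assoc, evalP_comp]
    simp only [hf]
  | prec cf cg hf hg =>
    intro n
    obtain ⟨x, k, rfl⟩ : ∃ x k, n = Nat.pair x k := ⟨_, _, (Nat.pair_unpair n).symm⟩
    simp only [tr, code_eval_comp, eval_assocInv, Part.bind_some]
    induction k with
    | zero => rw [Code.eval_prec_zero, evalP_prec_zero, hf]
    | succ k ih =>
      rw [Code.eval_prec_succ, ih, evalP_prec_succ]
      simp only [code_eval_comp, eval_assoc, Part.bind_some, hg, Part.bind_eq_bind]
  | rfind' cf hf =>
    intro n
    obtain ⟨x, k, rfl⟩ : ∃ x k, n = Nat.pair x k := ⟨_, _, (Nat.pair_unpair n).symm⟩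
    simp only [tr, code_eval_comp, eval_assocInv, Part.bind_some, code_eval_rfind', eval_assoc,
      evalP_rfind', hf]

/-- The translation is primitive recursive, by course-of-values recursion on the Gödel number. -/
theorem primrec_tr : Primrec fun e : ℕ => tr (ofNatCode e) := by
  let G : List Code → Option Code := fun L =>
    if L.length = 0 then some (tr zero) else
    if L.length = 1 then some (tr succ) else
    if L.length = 2 then some (tr left) else
    if L.length = 3 then some (tr right) else
    if L.length = 4 then some (tr oracle) else
    let n := L.length - 5
    let m := n.div2.div2
    let a := L.getD m.unpair.1 .zero
    let b := L.getD m.unpair.2 .zero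
    let c := L.getD m .zero
    some (bif n.bodd then
      (bif n.div2.bodd then .comp (.rfind' (.comp c assoc)) assocInv
        else .comp (.prec a (.comp b assoc)) assocInv)
      else (bif n.div2.bodd then .comp a (.pair .left b) else .pair a b))
  have hG : Primrec G := by
    have hlen (k : ℕ) : PrimrecPred fun L : List Code => L.length = k :=
      Primrec.eq.comp Primrec.list_length (Primrec.const k)
    have hn : Primrec fun L : List Code => L.length - 5 :=
      Primrec.nat_sub.comp Primrec.list_length (Primrec.const 5)
    have hm : Primrec fun L : List Code => (L.length - 5).div2.div2 :=
      Primrec.nat_div2.comp (Primrec.nat_div2.comp hn)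
    have hget {f : List Code → ℕ} (hf : Primrec f) :
        Primrec fun L : List Code => L.getD (f L) .zero :=
      (Primrec.list_getD _).comp Primrec.id hf
    have ha := hget (Primrec.fst.comp (Primrec.unpair.comp hm))
    have hb := hget (Primrec.snd.comp (Primrec.unpair.comp hm))
    have hc := hget hm
    have kc {f g : List Code → Code} (hf : Primrec f) (hg : Primrec g) :
        Primrec fun L => Code.comp (f L) (g L) := Code.primrec₂_comp.comp hf hg
    have kp {f g : List Code → Code} (hf : Primrec f) (hg : Primrec g) :
        Primrec fun L => Code.pair (f L) (g L) := Code.primrec₂_pair.comp hf hg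
    refine Primrec.ite (hlen 0) (Primrec.const _) <| Primrec.ite (hlen 1) (Primrec.const _) <|
      Primrec.ite (hlen 2) (Primrec.const _) <| Primrec.ite (hlen 3) (Primrec.const _) <|
      Primrec.ite (hlen 4) (Primrec.const _) <| Primrec.option_some.comp <|
      Primrec.cond (Primrec.nat_bodd.comp hn) (Primrec.cond
        (Primrec.nat_bodd.comp (Primrec.nat_div2.comp hn)) ?_ ?_) (Primrec.cond
        (Primrec.nat_bodd.comp (Primrec.nat_div2.comp hn)) ?_ ?_)
    · exact kc (Code.primrec_rfind'.comp (kc hc (Primrec.const _))) (Primrec.const _)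
    · exact kc (Code.primrec₂_prec.comp ha (kc hb (Primrec.const _))) (Primrec.const _)
    · exact kc ha (kp (Primrec.const _) hb)
    · exact kp ha hb
  have h := Primrec.nat_strong_rec (fun (_ : Unit) e => tr (ofNatCode e))
    (g := fun _ L => G L) (hG.comp Primrec.snd) ?_
  · exact h.comp (Primrec.const ()) Primrec.id
  · rintro ⟨⟩ n
    match n with
    | 0 => simp [G, ofNatCode]
    | 1 => simp [G, ofNatCode]
    | 2 => simp [G, ofNatCode]
    | 3 => simp [G, ofNatCode]
    | 4 => simp [G, ofNatCode]
    | n + 5 =>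
      have hm : n.div2.div2 < n + 5 := by simp only [Nat.div2_val]; omega
      have h1 : n.div2.div2.unpair.1 < n + 5 := lt_of_le_of_lt (Nat.unpair_left_le _) hm
      have h2 : n.div2.div2.unpair.2 < n + 5 := lt_of_le_of_lt (Nat.unpair_right_le _) hm
      simp only [G, List.length_map, List.length_range, ofNatCode.eq_6, Nat.add_sub_cancel,
        List.getD_eq_getElem?_getD, List.getElem?_map, List.getElem?_range, hm, h1, h2]
      cases n.bodd <;> cases n.div2.bodd <;> simp [tr]

/-! ### Computations from finite oracle strings -/

/-- Within `s` steps the `e`-th program, with some initial segment of the string `L` as its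
oracle, outputs `v` on input `y`.  Initial segments are allowed so that a computation seen with a
short string is not lost when the string grows, as the step count depends on the string. -/
def Bel (e : ℕ) (L : List ℕ) (y v s : ℕ) : Prop :=
  ∃ ℓ < s, v ∈ Code.evaln s (tr (ofNatCode e)) (Nat.pair (Encodable.encode (L.take ℓ)) y)

theorem Bel.sound {e : ℕ} {L : List ℕ} {y v s : ℕ} (h : Bel e L y v s) {g : ℕ →. ℕ}
    (hg : ∀ k w, L[k]? = some w → w ∈ g k) : v ∈ evalP g (ofNatCode e) y := by
  obtain ⟨ℓ, -, h⟩ := h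
  have h1 := Code.evaln_sound h
  rw [eval_tr] at h1
  refine evalP_mono (fun k w hw => hg k w ?_) h1
  rw [mem_strOracle, List.getElem?_take] at hw
  split at hw <;> simp_all

/-- A true computation is seen from some stage on with every string that is long enough and agrees
with the oracle on the use of the computation. -/
theorem eventually_bel {g : ℕ → ℕ} {e y v : ℕ} (h : v ∈ eval g (ofNatCode e) y) :
    ∃ ℓ, ∀ᶠ s in atTop, ∀ L : List ℕ, L.take ℓ = (List.range ℓ).map g → Bel e L y v s := by
  rw [← evalP_coe] at h
  obtain ⟨ℓ, hℓ⟩ := (eventually_evalP _ h).exists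
  have h1 : v ∈ evalP (strOracle ((List.range ℓ).map g)) (ofNatCode e) y := by
    refine hℓ _ fun k hk w hw => ?_
    rw [mem_strOracle]
    simpa [hk, eq_comm] using hw
  rw [← eval_tr, Code.evaln_complete] at h1
  obtain ⟨k, hk⟩ := h1
  refine ⟨ℓ, ?_⟩
  filter_upwards [eventually_ge_atTop k, eventually_gt_atTop ℓ] with s hs hs' L hL
  exact ⟨ℓ, hs', by rw [hL]; exact Code.evaln_mono hs hk⟩

theorem _root_.PrimrecPred.exists_lt_of {α : Type*} [Primcodable α] {R : α → ℕ → Prop} {f : α → ℕ}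
    (hR : PrimrecPred fun p : α × ℕ => R p.1 p.2) (hf : Primrec f) :
    PrimrecPred fun a => ∃ x < f a, R a x := by
  have h : PrimrecRel fun (x : ℕ) (a : α) => R a x := hR.comp (Primrec.pair Primrec.snd Primrec.fst)
  exact (h.exists_mem_list.comp (Primrec.list_range.comp hf) Primrec.id).of_eq (by simp)

theorem _root_.PrimrecPred.forall_lt_of {α : Type*} [Primcodable α] {R : α → ℕ → Prop} {f : α → ℕ}
    (hR : PrimrecPred fun p : α × ℕ => R p.1 p.2) (hf : Primrec f) :
    PrimrecPred fun a => ∀ x < f a, R a x := by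
  have h : PrimrecRel fun (x : ℕ) (a : α) => R a x := hR.comp (Primrec.pair Primrec.snd Primrec.fst)
  exact (h.forall_mem_list.comp (Primrec.list_range.comp hf) Primrec.id).of_eq (by simp)

theorem primrecPred_bel {α : Type*} [Primcodable α] {e y v s : α → ℕ} {L : α → List ℕ}
    (he : Primrec e) (hL : Primrec L) (hy : Primrec y) (hv : Primrec v) (hs : Primrec s) :
    PrimrecPred fun a => Bel (e a) (L a) (y a) (v a) (s a) := by
  refine PrimrecPred.exists_lt_of (R := fun a ℓ => Code.evaln (s a) (tr (ofNatCode (e a)))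
      (Nat.pair (Encodable.encode ((L a).take ℓ)) (y a)) = some (v a)) ?_ hs
  exact Primrec.eq.comp (Code.primrec_evaln.comp (Primrec.pair (Primrec.pair
      (hs.comp Primrec.fst) (primrec_tr.comp (he.comp Primrec.fst))) (Primrec₂.natPair.comp
      (Primrec.encode.comp (Primrec.list_take.comp Primrec.snd (hL.comp Primrec.fst)))
      (hy.comp Primrec.fst)))) (Primrec.option_some.comp (hv.comp Primrec.fst))

end OracleCode

open Filter OracleCode

/-! ### Approximating the jump of the halting problem -/

theorem charFn_of_mem {A : Set ℕ} {n : ℕ} (h : n ∈ A) : charFn A n = 1 := if_pos h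

theorem charFn_of_notMem {A : Set ℕ} {n : ℕ} (h : n ∉ A) : charFn A n = 0 := if_neg h

theorem charFn_le_one (A : Set ℕ) (n : ℕ) : charFn A n ≤ 1 := by
  unfold charFn; split <;> simp

/-- The initial segment of length `ℓ` of the characteristic function of `A`. -/
noncomputable def charStr (A : Set ℕ) (ℓ : ℕ) : List ℕ := (List.range ℓ).map (charFn A)

theorem getElem?_charStr {A : Set ℕ} {ℓ k w : ℕ} :
    (charStr A ℓ)[k]? = some w ↔ k < ℓ ∧ charFn A k = w := by
  simp only [charStr, List.getElem?_map, Option.map_eq_some_iff, List.getElem?_eq_some_iff,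
    List.length_range, List.getElem_range]
  constructor
  · rintro ⟨a, ⟨h, rfl⟩, rfl⟩; exact ⟨h, rfl⟩
  · rintro ⟨h, rfl⟩; exact ⟨k, ⟨h, rfl⟩, rfl⟩

theorem take_charStr (A : Set ℕ) {k ℓ : ℕ} (h : k ≤ ℓ) :
    (charStr A ℓ).take k = charStr A k := by
  rw [charStr, ← List.map_take, List.take_range, min_eq_left h, charStr]

theorem charStr_congr {A B : Set ℕ} {ℓ : ℕ} (h : ∀ k < ℓ, k ∈ A ↔ k ∈ B) :
    charStr A ℓ = charStr B ℓ := by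
  apply List.map_congr_left
  intro k hk
  have := h k (List.mem_range.1 hk)
  by_cases hB : k ∈ B
  · rw [charFn_of_mem hB, charFn_of_mem (this.2 hB)]
  · rw [charFn_of_notMem hB, charFn_of_notMem (mt this.1 hB)]

theorem primrec_charFn {α : Type*} [Primcodable α] {A : α → Set ℕ} {x : α → ℕ}
    (h : PrimrecPred fun a => x a ∈ A a) : Primrec fun a => charFn (A a) (x a) := by
  classical
  refine (Primrec.ite h (Primrec.const 1) (Primrec.const 0)).of_eq fun a => ?_
  simp [charFn]

theorem primrec_charStr {α : Type*} [Primcodable α] {A : α → Set ℕ} {ℓ : α → ℕ}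
    (h : PrimrecPred fun p : α × ℕ => p.2 ∈ A p.1) (hℓ : Primrec ℓ) :
    Primrec fun a => charStr (A a) (ℓ a) :=
  Primrec.list_map (Primrec.list_range.comp hℓ) (primrec_charFn h).to₂

theorem OracleCode.Bel.charStr_sound {A : Set ℕ} {e y v s ℓ : ℕ} (h : Bel e (charStr A ℓ) y v s) :
    v ∈ eval (charFn A) (ofNatCode e) y := by
  rw [← evalP_coe]
  refine h.sound fun k w hw => ?_
  rw [(getElem?_charStr.1 hw).2.symm]
  exact Part.mem_some _

/-- The version of `eventually_bel` for initial segments of characteristic functions. -/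
theorem eventually_bel_charStr {A : Set ℕ} {e y v : ℕ}
    (h : v ∈ eval (charFn A) (ofNatCode e) y) :
    ∃ ℓ, ∀ᶠ s in atTop, ∀ (B : Set ℕ) (ℓ' : ℕ), ℓ ≤ ℓ' → (∀ k < ℓ, k ∈ B ↔ k ∈ A) →
      Bel e (charStr B ℓ') y v s := by
  obtain ⟨ℓ, hℓ⟩ := eventually_bel h
  refine ⟨ℓ, hℓ.mono fun s hs B ℓ' hle hB => hs _ ?_⟩
  rw [take_charStr _ hle, charStr_congr hB, charStr]

/-- The part of the halting problem enumerated before stage `s`. -/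
def haltingStage (s : ℕ) : Set ℕ := {e | ∃ v < s, Bel e (charStr ∅ s) e v s}

theorem haltingStage_subset (s : ℕ) : haltingStage s ⊆ haltingSet := by
  rintro e ⟨v, -, hb⟩
  exact Part.dom_iff_mem.2 ⟨v, hb.charStr_sound⟩

theorem eventually_haltingStage {e : ℕ} (h : e ∈ haltingSet) :
    ∀ᶠ s in atTop, e ∈ haltingStage s := by
  obtain ⟨v, hv⟩ := Part.dom_iff_mem.1 h
  obtain ⟨ℓ, hℓ⟩ := eventually_bel_charStr (A := ∅) (e := e) hv
  filter_upwards [hℓ, eventually_ge_atTop ℓ, eventually_gt_atTop v] with s h1 h2 h3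
  exact ⟨v, h3, h1 ∅ s h2 fun _ _ => Iff.rfl⟩

theorem eventually_haltingStage_iff (ℓ : ℕ) :
    ∀ᶠ s in atTop, ∀ k < ℓ, k ∈ haltingStage s ↔ k ∈ haltingSet := by
  change ∀ᶠ s in atTop, ∀ k ∈ Set.Iio ℓ, k ∈ haltingStage s ↔ k ∈ haltingSet
  rw [eventually_all_finite (Set.finite_Iio ℓ)]
  intro k _
  by_cases h : k ∈ haltingSet
  · exact (eventually_haltingStage h).mono fun s hs => ⟨fun _ => h, fun _ => hs⟩
  · exact .of_forall fun s => ⟨fun hs => haltingStage_subset s hs, fun hk => absurd hk h⟩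

theorem primrecPred_haltingStage : PrimrecPred fun p : ℕ × ℕ => p.2 ∈ haltingStage p.1 := by
  refine PrimrecPred.exists_lt_of
    (R := fun p v => Bel p.2 (charStr ∅ p.1) p.2 v p.1) ?_ Primrec.fst
  have h2 : Primrec fun q : (ℕ × ℕ) × ℕ => q.1.2 := Primrec.snd.comp Primrec.fst
  have h1 : Primrec fun q : (ℕ × ℕ) × ℕ => q.1.1 := Primrec.fst.comp Primrec.fst
  refine primrecPred_bel h2 (primrec_charStr (A := fun _ => ∅) ?_ h1) h2 Primrec.snd h1
  exact (Primrec.eq.comp (Primrec.const 0) (Primrec.const 1)).of_eq fun _ => by simp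

/-- No number below `k` is enumerated into the halting problem at stage `s`. -/
def StableBelow (s k : ℕ) : Prop := ∀ x < k, x ∈ haltingStage (s + 1) → x ∈ haltingStage s

/-- The stage `s` guess that the `e`-th program with the halting problem as oracle halts on `e`:
it does so within `s` steps with an oracle string that is not changed at this very stage. -/
def jumpGuess (s : ℕ) : Set ℕ :=
  {e | ∃ k < s + 1, StableBelow s k ∧ ∃ v < s, Bel e (charStr (haltingStage s) k) e v s}

theorem eventually_mem_jumpGuess {e : ℕ} (h : e ∈ turingJump haltingSet) :
    ∀ᶠ s in atTop, e ∈ jumpGuess s := by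
  obtain ⟨v, hv⟩ := Part.dom_iff_mem.1 h
  obtain ⟨ℓ, hℓ⟩ := eventually_bel_charStr (A := haltingSet) (e := e) hv
  filter_upwards [hℓ, eventually_ge_atTop ℓ, eventually_gt_atTop v,
    eventually_haltingStage_iff ℓ] with s h1 h2 h3 h4
  exact ⟨ℓ, by omega, fun x hx hx' => (h4 x hx).2 (haltingStage_subset _ hx'), v, h3,
    h1 _ ℓ le_rfl h4⟩

/-- There are infinitely many stages whose guesses are all justified: take a stage which minimizes,
among all later stages, the bound below which the halting problem does not change. -/
theorem frequently_jumpGuess_subset : ∃ᶠ s in atTop, jumpGuess s ⊆ turingJump haltingSet := by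
  classical
  rw [frequently_atTop]
  intro S
  let κ : ℕ → ℕ := fun t => Nat.findGreatest (StableBelow t) t
  obtain ⟨s, hs, hmin⟩ : ∃ s ≥ S, ∀ t ≥ S, κ s ≤ κ t := by
    have h := WellFounded.min_mem (wellFounded_lt (α := ℕ)) (κ '' Set.Ici S)
      ⟨_, S, Set.self_mem_Ici, rfl⟩
    obtain ⟨s, hs, he⟩ := h
    exact ⟨s, hs, fun t ht => he ▸ (WellFounded.min_le _ (Set.mem_image_of_mem κ ht))⟩
  refine ⟨s, hs, ?_⟩
  rintro e ⟨k, hk, hst, v, -, hb⟩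
  have hkκ : k ≤ κ s := Nat.le_findGreatest (by omega) hst
  have hK : ∀ x < k, x ∈ haltingStage s ↔ x ∈ haltingSet := by
    refine fun x hx => ⟨fun h => haltingStage_subset s h, fun h => ?_⟩
    by_contra hn
    have key : ∀ t ≥ s, x ∉ haltingStage t := by
      intro t ht
      induction t, ht using Nat.le_induction with
      | base => exact hn
      | succ t ht ih =>
        intro h'
        have h1 := hmin t (hs.trans ht)
        have h2 : StableBelow t (κ t) :=
          Nat.findGreatest_spec (P := StableBelow t) (Nat.zero_le t) fun x hx => absurd hx (by simp)
        exact ih (h2 x (by omega) h')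
    obtain ⟨t, h1, h2⟩ := ((eventually_haltingStage h).and (eventually_ge_atTop s)).exists
    exact key t h2 h1
  rw [charStr_congr hK] at hb
  exact Part.dom_iff_mem.2 ⟨v, hb.charStr_sound⟩

theorem primrecPred_jumpGuess : PrimrecPred fun p : ℕ × ℕ => p.2 ∈ jumpGuess p.1 := by
  have ha {α : Type} [Primcodable α] {f g : α → ℕ} (hf : Primrec f) (hg : Primrec g) :
      PrimrecPred fun a => g a ∈ haltingStage (f a) :=
    primrecPred_haltingStage.comp (Primrec.pair hf hg)
  refine PrimrecPred.exists_lt_of (R := fun p k => StableBelow p.1 k ∧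
    ∃ v < p.1, Bel p.2 (charStr (haltingStage p.1) k) p.2 v p.1) ?_ (Primrec.succ.comp Primrec.fst)
  refine PrimrecPred.and ?_ ?_
  · refine PrimrecPred.forall_lt_of (R := fun (q : (ℕ × ℕ) × ℕ) x =>
      x ∈ haltingStage (q.1.1 + 1) → x ∈ haltingStage q.1.1) ?_ Primrec.snd
    have h1 : Primrec fun q : ((ℕ × ℕ) × ℕ) × ℕ => q.1.1.1 :=
      Primrec.fst.comp (Primrec.fst.comp Primrec.fst)
    exact ((ha (Primrec.succ.comp h1) Primrec.snd).not.or (ha h1 Primrec.snd)).of_eq fun q => by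
      simp only [Nat.succ_eq_add_one]; tauto
  · refine PrimrecPred.exists_lt_of (R := fun (q : (ℕ × ℕ) × ℕ) v =>
      Bel q.1.2 (charStr (haltingStage q.1.1) q.2) q.1.2 v q.1.1) ?_ (Primrec.fst.comp Primrec.fst)
    have h1 : Primrec fun q : ((ℕ × ℕ) × ℕ) × ℕ => q.1.1.1 :=
      Primrec.fst.comp (Primrec.fst.comp Primrec.fst)
    have h2 : Primrec fun q : ((ℕ × ℕ) × ℕ) × ℕ => q.1.1.2 :=
      Primrec.snd.comp (Primrec.fst.comp Primrec.fst)
    exact primrecPred_bel h2 (primrec_charStr (A := fun q : ((ℕ × ℕ) × ℕ) × ℕ =>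
      haltingStage q.1.1.1) (ha (h1.comp Primrec.fst) Primrec.snd) (Primrec.snd.comp Primrec.fst))
      h2 Primrec.snd h1

/-- The number with the `l` binary digits `charFn B 0, …, charFn B (l - 1)`, most significant
digit first.  For fixed `l` the numerical order is the lexicographic order of initial segments. -/
noncomputable def prefixNum (B : Set ℕ) : ℕ → ℕ
  | 0 => 0
  | l + 1 => 2 * prefixNum B l + charFn B l

theorem prefixNum_congr {B C : Set ℕ} {l : ℕ} (h : ∀ i < l, charFn B i = charFn C i) :
    prefixNum B l = prefixNum C l := by
  induction l with
  | zero => rfl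
  | succ l ih => rw [prefixNum, prefixNum, ih fun i hi => h i (by omega), h l (by omega)]

theorem prefixNum_le {B C : Set ℕ} {l : ℕ} (h : ∀ i < l, charFn B i ≤ charFn C i) :
    prefixNum B l ≤ prefixNum C l := by
  induction l with
  | zero => rfl
  | succ l ih =>
    have h1 := ih fun i hi => h i (by omega)
    have h2 := h l (by omega)
    simp only [prefixNum]
    omega

theorem prefixNum_mono {B C : Set ℕ} {l l' : ℕ} (hl : l ≤ l')
    (h : prefixNum B l' ≤ prefixNum C l') : prefixNum B l ≤ prefixNum C l := by
  induction l', hl using Nat.le_induction with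
  | base => exact h
  | succ l' hl ih =>
    apply ih
    have h1 := charFn_le_one B l'
    have h2 := charFn_le_one C l'
    simp only [prefixNum] at h
    omega

/-- The guess used by the construction at stage `s`.  The stages with the same `Nat.sqrt s` share
the guess and are distinguished by `stageIdx s`. -/
def stageGuess (s : ℕ) : Set ℕ := jumpGuess s.sqrt

/-- The index of the requirement which the construction considers at stage `s`. -/
def stageIdx (s : ℕ) : ℕ := s - s.sqrt * s.sqrt

/-- The stage `s` approximation of the first `l` bits of the jump of the halting problem. -/
noncomputable def pathNum (s l : ℕ) : ℕ := prefixNum (stageGuess s) l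

/-- The first `l` bits of the jump of the halting problem. -/
noncomputable def truePath (l : ℕ) : ℕ := prefixNum (turingJump haltingSet) l

theorem tendsto_sqrt : Tendsto Nat.sqrt atTop atTop :=
  tendsto_atTop.2 fun b => (eventually_ge_atTop (b * b)).mono fun _ h => Nat.le_sqrt.2 h

theorem eventually_mem_stageGuess {e : ℕ} (h : e ∈ turingJump haltingSet) :
    ∀ᶠ s in atTop, e ∈ stageGuess s :=
  tendsto_sqrt.eventually (eventually_mem_jumpGuess h)

theorem eventually_truePath_le (l : ℕ) : ∀ᶠ s in atTop, truePath l ≤ pathNum s l := by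
  have h : ∀ᶠ s in atTop, ∀ i ∈ Set.Iio l, i ∈ turingJump haltingSet → i ∈ stageGuess s := by
    rw [eventually_all_finite (Set.finite_Iio l)]
    intro i _
    by_cases hi : i ∈ turingJump haltingSet
    · exact (eventually_mem_stageGuess hi).mono fun _ h _ => h
    · exact .of_forall fun _ h => absurd h hi
  refine h.mono fun s hs => prefixNum_le fun i hi => ?_
  by_cases h1 : i ∈ turingJump haltingSet
  · rw [charFn_of_mem h1, charFn_of_mem (hs i hi h1)]
  · rw [charFn_of_notMem h1]; exact Nat.zero_le _

/-- The guess is right on its first `l` bits infinitely often, with every requirement index. -/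
theorem frequently_pathNum_eq (l m : ℕ) :
    ∃ᶠ s in atTop, pathNum s l = truePath l ∧ stageIdx s = m := by
  have h : ∀ᶠ s in atTop, ∀ i ∈ Set.Iio l, i ∈ turingJump haltingSet → i ∈ jumpGuess s := by
    rw [eventually_all_finite (Set.finite_Iio l)]
    intro i _
    by_cases hi : i ∈ turingJump haltingSet
    · exact (eventually_mem_jumpGuess hi).mono fun _ h _ => h
    · exact .of_forall fun _ h => absurd h hi
  rw [frequently_atTop]
  intro S
  obtain ⟨q, hq, h1, h2, h3⟩ := (frequently_jumpGuess_subset.and_eventually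
    (h.and ((eventually_ge_atTop m).and (eventually_ge_atTop S)))).exists
  have hsq : (q * q + m).sqrt = q := Nat.sqrt_add_eq q (by omega)
  refine ⟨q * q + m, h3.trans ((Nat.le_mul_self q).trans (Nat.le_add_right _ _)), ?_, ?_⟩
  · refine prefixNum_congr fun i hi => ?_
    rw [stageGuess, hsq]
    by_cases hK : i ∈ turingJump haltingSet
    · rw [charFn_of_mem hK, charFn_of_mem (h1 i hi hK)]
    · rw [charFn_of_notMem hK, charFn_of_notMem fun hc => hK (hq hc)]
  · rw [stageIdx, hsq]; omega

theorem primrecPred_stageGuess : PrimrecPred fun p : ℕ × ℕ => p.2 ∈ stageGuess p.1 :=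
  primrecPred_jumpGuess.comp (Primrec.pair (Primrec.nat_sqrt.comp Primrec.fst) Primrec.snd)

theorem primrec_pathNum : Primrec₂ pathNum := by
  have h : Primrec fun p : ℕ × ℕ => (Nat.rec 0
      (fun i r => 2 * r + charFn (stageGuess p.1) i) p.2 : ℕ) := by
    refine Primrec.nat_rec' (h := fun (p : ℕ × ℕ) (q : ℕ × ℕ) =>
      2 * q.2 + charFn (stageGuess p.1) q.1) Primrec.snd (Primrec.const 0) ?_
    refine Primrec.nat_add.comp (Primrec.nat_mul.comp (Primrec.const 2)
      (Primrec.snd.comp Primrec.snd)) (primrec_charFn (α := (ℕ × ℕ) × (ℕ × ℕ))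
        (A := fun p => stageGuess p.1.1) (x := fun p => p.2.1) ?_)
    exact primrecPred_stageGuess.comp (Primrec.pair (Primrec.fst.comp Primrec.fst) (Primrec.fst.comp Primrec.snd))
  refine h.of_eq fun p => ?_
  obtain ⟨s, l⟩ := p
  induction l with
  | zero => rfl
  | succ l ih => simp only [pathNum, prefixNum] at ih ⊢; rw [← ih]

theorem primrec_stageIdx : Primrec stageIdx :=
  Primrec.nat_sub.comp Primrec.id (Primrec.nat_mul.comp Primrec.nat_sqrt Primrec.nat_sqrt)

/-! ### The construction -/

/-- The length of the node whose requirement is considered at stage `s`. -/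
def nodeLen (s : ℕ) : ℕ := (stageIdx s).unpair.1

/-- The stage at which the requirement considered at stage `s` was started; its node consists of
the first `nodeLen s` bits of the guess at that stage. -/
def nodeStart (s : ℕ) : ℕ := (stageIdx s).unpair.2

/-- The requirement considered at stage `s` may act: the guess at stage `s` passes through its node,
no guess since `nodeStart s` lies to the left of the node, and the requirement is not a duplicate
of one that was started at the same node before and is still intact. -/
def Active (s : ℕ) : Prop :=
  nodeStart s < s + 1 ∧ pathNum s (nodeLen s) = pathNum (nodeStart s) (nodeLen s) ∧
  (∀ u < s + 1, nodeStart s ≤ u →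
    pathNum (nodeStart s) (nodeLen s) ≤ pathNum u (nodeLen s)) ∧
  ∀ t < nodeStart s, pathNum t (nodeLen s) = pathNum (nodeStart s) (nodeLen s) →
    ∃ u < nodeStart s, t < u ∧ pathNum u (nodeLen s) < pathNum (nodeStart s) (nodeLen s)

/-- Given the list `S` of the earlier attacks `(stage, argument)`, the `j`-th marker appointed at
stage `t` is enumerated at stage `s`: the guess has moved to the left of the guess at stage `t`,
and no attack of a requirement of higher priority has frozen the marker. -/
def Released (S : List (ℕ × ℕ)) (j t s : ℕ) : Prop :=
  t < s ∧ pathNum s (j + 1) < pathNum t (j + 1) ∧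
  ∀ p ∈ S, ¬ (t < p.1 ∧ p.1 < s ∧ nodeLen p.1 ≤ j ∧
    pathNum p.1 (nodeLen p.1) = pathNum t (nodeLen p.1))

/-- The numbers enumerated up to stage `s`, given the list `S` of attacks.  The `j`-th marker
appointed at stage `t` is the number `Nat.pair j t + 2`; the numbers `1` and `0` are put in and
kept out once and for all. -/
def enumStage (S : List (ℕ × ℕ)) (s : ℕ) : Set ℕ :=
  {x | x = 1 ∨ 2 ≤ x ∧ ∃ s' < s + 1, Released S (x - 2).unpair.1 (x - 2).unpair.2 s'}

/-- At stage `s` the opponent is seen to converge on `y`, with a value that is not smaller than the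
stages of all earlier attacks of the requirement considered at stage `s`. -/
def Beats (S : List (ℕ × ℕ)) (s y : ℕ) : Prop :=
  ∃ v < s, (∀ p ∈ S, stageIdx p.1 = stageIdx s → p.1 ≤ v) ∧
    Bel (nodeLen s).unpair.1 (charStr (enumStage S s) s) y v s

open Classical in
/-- The attack made at stage `s`, if any: the least argument on which the opponent beats all earlier
attacks of the requirement. -/
noncomputable def nextAttack (S : List (ℕ × ℕ)) (s : ℕ) : Option ℕ :=
  if Active s then ((List.range (2 ^ (stageIdx s + 1))).filter (Beats S s ·)).head? else none

/-- The list of the attacks `(stage, argument)` made before stage `s`. -/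
noncomputable def attacks : ℕ → List (ℕ × ℕ)
  | 0 => []
  | s + 1 => attacks s ++ ((nextAttack (attacks s) s).map (Prod.mk s)).toList

/-- An attack triggered by the argument `y` is made at stage `s`. -/
def Attack (s y : ℕ) : Prop := nextAttack (attacks s) s = some y

/-- The part of the constructed set enumerated up to stage `s`. -/
def setStage (s : ℕ) : Set ℕ := enumStage (attacks s) s

/-- The recursively enumerable set which is high and not pdominant. -/
def highSet : Set ℕ := {x | ∃ s, x ∈ setStage s}

theorem mem_attacks {s y t : ℕ} : (s, y) ∈ attacks t ↔ s < t ∧ Attack s y := by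
  induction t with
  | zero => simp [attacks]
  | succ t ih =>
    rw [attacks, List.mem_append, ih]
    simp only [Option.mem_toList, Option.map_eq_some_iff, Prod.mk.injEq]
    constructor
    · rintro (⟨h1, h2⟩ | ⟨a, h, rfl, rfl⟩)
      · exact ⟨by omega, h2⟩
      · exact ⟨by omega, h⟩
    · rintro ⟨h1, h2⟩
      rcases Nat.lt_succ_iff_lt_or_eq.1 h1 with h | rfl
      · exact .inl ⟨h, h2⟩
      · exact .inr ⟨y, h2, rfl, rfl⟩

theorem attacks_prefix {s t : ℕ} (h : s ≤ t) : attacks s <+: attacks t := by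
  induction t, h using Nat.le_induction with
  | base => exact List.prefix_rfl
  | succ t _ ih => exact ih.trans (List.prefix_append _ _)

theorem released_attacks {j t s s' : ℕ} (h : s' ≤ s) :
    Released (attacks s) j t s' ↔ Released (attacks s') j t s' := by
  refine and_congr_right fun _ => and_congr_right fun _ => ⟨fun hp p hps => ?_, fun hp p hps => ?_⟩
  · exact hp p ((attacks_prefix h).subset hps)
  · rintro ⟨h1, h2, h3⟩
    exact hp p (mem_attacks.2 ⟨h2, (mem_attacks.1 hps).2⟩) ⟨h1, h2, h3⟩

theorem mem_setStage {x s : ℕ} : x ∈ setStage s ↔ x = 1 ∨ 2 ≤ x ∧ ∃ s' ≤ s,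
    Released (attacks s') (x - 2).unpair.1 (x - 2).unpair.2 s' := by
  refine or_congr_right (and_congr_right fun _ => exists_congr fun s' => ?_)
  rw [Nat.lt_succ_iff]
  exact and_congr_right fun h => released_attacks h

theorem setStage_mono {s t : ℕ} (h : s ≤ t) : setStage s ⊆ setStage t := by
  intro x hx
  rw [mem_setStage] at hx ⊢
  exact hx.imp_right fun ⟨h2, s', hs', hr⟩ => ⟨h2, s', hs'.trans h, hr⟩

theorem one_mem_highSet : 1 ∈ highSet := ⟨0, .inl rfl⟩

theorem zero_notMem_highSet : 0 ∉ highSet := by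
  rintro ⟨s, h | ⟨h, -⟩⟩ <;> omega

theorem marker_mem_highSet {j t : ℕ} :
    Nat.pair j t + 2 ∈ highSet ↔ ∃ s, Released (attacks s) j t s := by
  constructor
  · rintro ⟨s, hs⟩
    rw [mem_setStage] at hs
    rcases hs with h | ⟨-, s', -, h⟩
    · omega
    · rw [Nat.add_sub_cancel, Nat.unpair_pair] at h; exact ⟨s', h⟩
  · rintro ⟨s, hs⟩
    refine ⟨s, mem_setStage.2 (.inr ⟨by omega, s, le_rfl, ?_⟩)⟩
    rwa [Nat.add_sub_cancel, Nat.unpair_pair]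

theorem Attack.active {s y : ℕ} (h : Attack s y) : Active s := by
  by_contra hn
  rw [Attack, nextAttack, if_neg hn] at h
  simp at h

theorem Attack.lt_and_beats {s y : ℕ} (h : Attack s y) :
    y < 2 ^ (stageIdx s + 1) ∧ Beats (attacks s) s y := by
  classical
  have ha := h.active
  rw [Attack, nextAttack, if_pos ha] at h
  have hm := List.mem_of_head? h
  simpa using hm

theorem exists_attack {s y : ℕ} (ha : Active s) (hy : y < 2 ^ (stageIdx s + 1))
    (hb : Beats (attacks s) s y) : ∃ y', Attack s y' := by
  classical
  have hm : y ∈ (List.range (2 ^ (stageIdx s + 1))).filter (Beats (attacks s) s ·) := by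
    simpa using ⟨hy, hb⟩
  unfold Attack nextAttack
  rw [if_pos ha]
  exact Option.isSome_iff_exists.1 (List.isSome_head?.2 (List.ne_nil_of_mem hm))

/-! ### Computability of the construction -/

theorem primrec_nodeLen : Primrec nodeLen :=
  Primrec.fst.comp (Primrec.unpair.comp primrec_stageIdx)

theorem primrec_nodeStart : Primrec nodeStart :=
  Primrec.snd.comp (Primrec.unpair.comp primrec_stageIdx)

theorem PrimrecPred.imp {α : Type*} [Primcodable α] {p q : α → Prop} (hp : PrimrecPred p)
    (hq : PrimrecPred q) : PrimrecPred fun a => p a → q a :=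
  (hp.not.or hq).of_eq fun _ => by tauto

theorem primrecPred_active : PrimrecPred Active := by
  have hN {α : Type} [Primcodable α] {f g : α → ℕ} (hf : Primrec f) (hg : Primrec g) :
      Primrec fun a => pathNum (f a) (g a) := primrec_pathNum.comp hf hg
  have hl := primrec_nodeLen
  have hr := primrec_nodeStart
  have f1 : Primrec (Prod.fst : ℕ × ℕ → ℕ) := Primrec.fst
  have f2 : Primrec (Prod.snd : ℕ × ℕ → ℕ) := Primrec.snd
  refine (Primrec.nat_lt.comp hr Primrec.succ).and <| (Primrec.eq.comp (hN Primrec.id hl)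
    (hN hr hl)).and <| PrimrecPred.and ?_ ?_
  · refine PrimrecPred.forall_lt_of (R := fun s u => nodeStart s ≤ u →
      pathNum (nodeStart s) (nodeLen s) ≤ pathNum u (nodeLen s)) ?_ Primrec.succ
    exact (Primrec.nat_le.comp (hr.comp f1) f2).imp
      (Primrec.nat_le.comp (hN (hr.comp f1) (hl.comp f1)) (hN f2 (hl.comp f1)))
  · refine PrimrecPred.forall_lt_of (R := fun s t =>
      pathNum t (nodeLen s) = pathNum (nodeStart s) (nodeLen s) →
      ∃ u < nodeStart s, t < u ∧ pathNum u (nodeLen s) < pathNum (nodeStart s) (nodeLen s)) ?_ hr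
    refine (Primrec.eq.comp (hN f2 (hl.comp f1)) (hN (hr.comp f1) (hl.comp f1))).imp ?_
    refine PrimrecPred.exists_lt_of (R := fun (p : ℕ × ℕ) u => p.2 < u ∧
      pathNum u (nodeLen p.1) < pathNum (nodeStart p.1) (nodeLen p.1)) ?_ (hr.comp f1)
    have g1 : Primrec fun q : (ℕ × ℕ) × ℕ => q.1.1 := Primrec.fst.comp Primrec.fst
    exact (Primrec.nat_lt.comp (Primrec.snd.comp Primrec.fst) Primrec.snd).and
      (Primrec.nat_lt.comp (hN Primrec.snd (hl.comp g1)) (hN (hr.comp g1) (hl.comp g1)))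

theorem primrecPred_released {α : Type} [Primcodable α] {S : α → List (ℕ × ℕ)} {j t s : α → ℕ}
    (hS : Primrec S) (hj : Primrec j) (ht : Primrec t) (hs : Primrec s) :
    PrimrecPred fun a => Released (S a) (j a) (t a) (s a) := by
  have hN {α : Type} [Primcodable α] {f g : α → ℕ} (hf : Primrec f) (hg : Primrec g) :
      Primrec fun a => pathNum (f a) (g a) := primrec_pathNum.comp hf hg
  have hj' : Primrec fun a => j a + 1 := Primrec.succ.comp hj
  refine (Primrec.nat_lt.comp ht hs).and <| (Primrec.nat_lt.comp (hN hs hj') (hN ht hj')).and ?_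
  have hR : PrimrecRel fun (p : ℕ × ℕ) (a : α) => ¬ (t a < p.1 ∧ p.1 < s a ∧
      nodeLen p.1 ≤ j a ∧ pathNum p.1 (nodeLen p.1) = pathNum (t a) (nodeLen p.1)) := by
    have g1 : Primrec fun q : (ℕ × ℕ) × α => q.1.1 := Primrec.fst.comp Primrec.fst
    have gl := primrec_nodeLen.comp g1
    have gt : Primrec fun q : (ℕ × ℕ) × α => t q.2 := ht.comp Primrec.snd
    have gs : Primrec fun q : (ℕ × ℕ) × α => s q.2 := hs.comp Primrec.snd
    have gj : Primrec fun q : (ℕ × ℕ) × α => j q.2 := hj.comp Primrec.snd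
    exact ((Primrec.nat_lt.comp gt g1).and <| (Primrec.nat_lt.comp g1 gs).and <|
      (Primrec.nat_le.comp gl gj).and (Primrec.eq.comp (hN g1 gl) (hN gt gl))).not
  exact hR.forall_mem_list.comp hS Primrec.id

theorem primrecPred_enumStage {α : Type} [Primcodable α] {S : α → List (ℕ × ℕ)} {s x : α → ℕ}
    (hS : Primrec S) (hs : Primrec s) (hx : Primrec x) :
    PrimrecPred fun a => x a ∈ enumStage (S a) (s a) := by
  refine (Primrec.eq.comp hx (Primrec.const 1)).or <|
    (Primrec.nat_le.comp (Primrec.const 2) hx).and ?_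
  refine PrimrecPred.exists_lt_of (R := fun a s' =>
    Released (S a) (x a - 2).unpair.1 (x a - 2).unpair.2 s') ?_ (Primrec.succ.comp hs)
  have hu : Primrec fun p : α × ℕ => (x p.1 - 2).unpair :=
    Primrec.unpair.comp (Primrec.nat_sub.comp (hx.comp Primrec.fst) (Primrec.const 2))
  exact primrecPred_released (α := α × ℕ) (hS.comp Primrec.fst) (Primrec.fst.comp hu)
    (Primrec.snd.comp hu) Primrec.snd

theorem primrecPred_beats {α : Type} [Primcodable α] {S : α → List (ℕ × ℕ)} {s y : α → ℕ}
    (hS : Primrec S) (hs : Primrec s) (hy : Primrec y) :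
    PrimrecPred fun a => Beats (S a) (s a) (y a) := by
  refine PrimrecPred.exists_lt_of (R := fun a v =>
    (∀ p ∈ S a, stageIdx p.1 = stageIdx (s a) → p.1 ≤ v) ∧
    Bel (nodeLen (s a)).unpair.1 (charStr (enumStage (S a) (s a)) (s a)) (y a) v (s a)) ?_ hs
  have hs' : Primrec fun p : α × ℕ => s p.1 := hs.comp Primrec.fst
  refine PrimrecPred.and ?_ ?_
  · have hR : PrimrecRel fun (p : ℕ × ℕ) (q : α × ℕ) =>
        stageIdx p.1 = stageIdx (s q.1) → p.1 ≤ q.2 := by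
      have g1 : Primrec fun q : (ℕ × ℕ) × (α × ℕ) => q.1.1 := Primrec.fst.comp Primrec.fst
      exact (Primrec.eq.comp (primrec_stageIdx.comp g1)
        (primrec_stageIdx.comp (hs'.comp Primrec.snd))).imp
        (Primrec.nat_le.comp g1 (Primrec.snd.comp Primrec.snd))
    exact hR.forall_mem_list.comp (hS.comp Primrec.fst) Primrec.id
  · refine primrecPred_bel (α := α × ℕ)
      (Primrec.fst.comp (Primrec.unpair.comp (primrec_nodeLen.comp hs')))
      (primrec_charStr (α := α × ℕ) (A := fun p => enumStage (S p.1) (s p.1)) ?_ hs')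
      (hy.comp Primrec.fst) Primrec.snd hs'
    exact primrecPred_enumStage (hS.comp (Primrec.fst.comp Primrec.fst))
      (hs'.comp Primrec.fst) Primrec.snd

theorem primrec_nextAttack : Primrec₂ nextAttack := by
  classical
  have hR : PrimrecRel fun (y : ℕ) (p : List (ℕ × ℕ) × ℕ) => Beats p.1 p.2 y :=
    primrecPred_beats (Primrec.fst.comp Primrec.snd) (Primrec.snd.comp Primrec.snd) Primrec.fst
  have hpow : Primrec fun p : List (ℕ × ℕ) × ℕ => 2 ^ (stageIdx p.2 + 1) :=
    (Primrec₂.unpaired'.1 Nat.Primrec.pow).comp (Primrec.const 2)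
      (Primrec.succ.comp (primrec_stageIdx.comp Primrec.snd))
  refine (Primrec.ite (primrecPred_active.comp Primrec.snd) (Primrec.list_head?.comp
    (hR.listFilter.comp (Primrec.list_range.comp hpow) Primrec.id)) (Primrec.const none)).of_eq ?_
  rintro ⟨S, s⟩
  simp only [nextAttack, id]

theorem primrec_attacks : Primrec attacks := by
  refine (Primrec.nat_rec₁ (f := fun s S => S ++ ((nextAttack S s).map (Prod.mk s)).toList) []
    ?_).of_eq fun s => ?_
  · exact Primrec.list_append.comp Primrec.snd (Primrec.optionToList.comp (Primrec.option_map
      (primrec_nextAttack.comp Primrec.snd Primrec.fst)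
      (Primrec.pair (Primrec.fst.comp Primrec.fst) Primrec.snd)))
  · induction s with
    | zero => rfl
    | succ s ih => simp only [attacks]; rw [← ih]

/-- Search for a witness of a primitive recursive relation. -/
theorem exists_partrec_search {P : ℕ → ℕ → Prop} (hP : PrimrecPred fun p : ℕ × ℕ => P p.1 p.2) :
    ∃ φ : ℕ →. ℕ, Nat.Partrec φ ∧ (∀ x t, t ∈ φ x → P x t) ∧ ∀ x t, P x t → (φ x).Dom := by
  classical
  have h : Partrec fun x => Nat.rfind fun s => (Part.some (decide (P x s)) : Part Bool) := by
    apply Partrec.rfind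
    exact hP.decide.to_comp.partrec.to₂
  refine ⟨_, Partrec.nat_iff.1 h, fun x t ht => ?_, fun x t ht => ?_⟩
  · simpa using (Nat.mem_rfind.1 ht).1
  · exact Nat.rfind_dom'.2 ⟨t, by simpa using ht, fun _ => trivial⟩

theorem rePred_of_exists {P : ℕ → ℕ → Prop} (hP : PrimrecPred fun p : ℕ × ℕ => P p.1 p.2) :
    REPred fun x => ∃ s, P x s := by
  obtain ⟨φ, hφ, h1, h2⟩ := exists_partrec_search hP
  refine (Partrec.nat_iff.2 hφ).dom_re.of_eq fun x => ⟨fun h => ?_, fun ⟨s, hs⟩ => h2 x s hs⟩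
  exact ⟨_, h1 x _ (Part.get_mem h)⟩

theorem isRE_highSet : IsRE highSet :=
  rePred_of_exists (P := fun x s => x ∈ setStage s)
    (primrecPred_enumStage (primrec_attacks.comp Primrec.snd) Primrec.snd Primrec.fst)

/-! ### Requirements on the true path -/

theorem exists_startStage (l : ℕ) :
    ∃ r, pathNum r l = truePath l ∧ ∀ u ≥ r, truePath l ≤ pathNum u l := by
  obtain ⟨r, hr⟩ := eventually_atTop.1 (eventually_truePath_le l)
  obtain ⟨s, hs, h, -⟩ := frequently_atTop.1 (frequently_pathNum_eq l 0) r
  exact ⟨s, h, fun u hu => hr u (hs.trans hu)⟩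

open Classical in
/-- The least stage at which the guess passes through the node of length `l` on the true path
and after which no guess lies to the left of this node. -/
noncomputable def startStage (l : ℕ) : ℕ := Nat.find (exists_startStage l)

open Classical in
theorem pathNum_startStage (l : ℕ) : pathNum (startStage l) l = truePath l :=
  (Nat.find_spec (exists_startStage l)).1

open Classical in
theorem truePath_le_pathNum {l u : ℕ} (h : startStage l ≤ u) : truePath l ≤ pathNum u l :=
  (Nat.find_spec (exists_startStage l)).2 u h

/-- The index of the requirement at the node of length `l` on the true path which is never
given up. -/
noncomputable def trueIdx (l : ℕ) : ℕ := Nat.pair l (startStage l)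

theorem nodeLen_eq {s l : ℕ} (h : stageIdx s = trueIdx l) : nodeLen s = l := by
  rw [nodeLen, h, trueIdx, Nat.unpair_pair]

theorem nodeStart_eq {s l : ℕ} (h : stageIdx s = trueIdx l) : nodeStart s = startStage l := by
  rw [nodeStart, h, trueIdx, Nat.unpair_pair]

open Classical in
theorem exists_lt_of_lt_startStage {l t : ℕ} (ht : t < startStage l)
    (h : pathNum t l = truePath l) :
    ∃ u < startStage l, t < u ∧ pathNum u l < truePath l := by
  have hmin := Nat.find_min (exists_startStage l) ht
  push Not at hmin
  obtain ⟨u, hu, hlt⟩ := hmin h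
  refine ⟨u, ?_, ?_, hlt⟩
  · by_contra hc
    exact absurd (truePath_le_pathNum (not_lt.1 hc)) (by omega)
  · exact lt_of_le_of_ne hu (by rintro rfl; omega)

theorem active_of_pathNum_eq {s l : ℕ} (h : stageIdx s = trueIdx l) (hs : startStage l ≤ s)
    (hp : pathNum s l = truePath l) : Active s := by
  unfold Active
  rw [nodeLen_eq h, nodeStart_eq h, pathNum_startStage]
  exact ⟨by omega, hp, fun u _ hu => truePath_le_pathNum hu,
    fun t ht htp => exists_lt_of_lt_startStage ht htp⟩

theorem frequently_active (l : ℕ) : ∃ᶠ s in atTop, Active s ∧ stageIdx s = trueIdx l :=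
  ((frequently_pathNum_eq l (trueIdx l)).and_eventually
    (eventually_ge_atTop (startStage l))).mono fun _ h =>
      ⟨active_of_pathNum_eq h.1.2 h.2 h.1.1, h.1.2⟩

theorem eventually_mem_setStage_iff (ℓ : ℕ) :
    ∀ᶠ s in atTop, ∀ k < ℓ, k ∈ setStage s ↔ k ∈ highSet := by
  change ∀ᶠ s in atTop, ∀ k ∈ Set.Iio ℓ, k ∈ setStage s ↔ k ∈ highSet
  rw [eventually_all_finite (Set.finite_Iio ℓ)]
  intro k _
  by_cases h : k ∈ highSet
  · obtain ⟨s, hs⟩ := h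
    exact (eventually_ge_atTop s).mono fun t ht =>
      ⟨fun h => ⟨t, h⟩, fun _ => setStage_mono ht hs⟩
  · exact .of_forall fun s => ⟨fun hs => ⟨s, hs⟩, fun hk => absurd hk h⟩

/-- An attack at a node that is never passed on the left preserves the initial segment it has
used.  A marker appointed before the attack and released after it would require a move of the guess
to the left: a move above the node is excluded by the assumption, a move which had taken place
before the attack would have released the marker by then, and for any other move the attack has
frozen the marker. -/
theorem mem_setStage_iff_of_attack {s y k : ℕ} (h : Attack s y)
    (hr : ∀ u ≥ nodeStart s, pathNum (nodeStart s) (nodeLen s) ≤ pathNum u (nodeLen s))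
    (hk : k < s) : k ∈ setStage s ↔ k ∈ highSet := by
  refine ⟨fun hs => ⟨s, hs⟩, fun ⟨s₁, hs₁⟩ => ?_⟩
  rw [mem_setStage] at hs₁ ⊢
  refine hs₁.imp_right fun ⟨h2, s', _, hrel⟩ => ⟨h2, ?_⟩
  by_cases hle : s' ≤ s
  · exact ⟨s', hle, hrel⟩
  push Not at hle
  set j := (k - 2).unpair.1
  set t := (k - 2).unpair.2
  have ht : t < s := (Nat.unpair_right_le (k - 2)).trans_lt (by omega)
  obtain ⟨-, hlt, hfree⟩ := hrel
  obtain ⟨hrs, hps, -⟩ := h.active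
  by_cases hst : pathNum s (j + 1) < pathNum t (j + 1)
  · refine ⟨s, le_rfl, ht, hst, fun p hp ⟨h3, h4, h5⟩ => ?_⟩
    exact hfree p ((attacks_prefix hle.le).subset hp) ⟨h3, h4.trans hle, h5⟩
  exfalso
  push Not at hst
  have hs' : pathNum s (nodeLen s) ≤ pathNum s' (nodeLen s) :=
    hps.trans_le (hr s' (by omega))
  rcases le_or_gt (nodeLen s) j with hj | hj
  · have h3 : pathNum t (nodeLen s) ≤ pathNum s (nodeLen s) := prefixNum_mono (by omega) hst
    have h4 : pathNum s' (nodeLen s) ≤ pathNum t (nodeLen s) := prefixNum_mono (by omega) hlt.le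
    exact hfree (s, y) (mem_attacks.2 ⟨hle, h⟩) 
      ⟨ht, hle, hj, le_antisymm (hs'.trans h4) h3⟩
  · have h3 : pathNum s (j + 1) ≤ pathNum s' (j + 1) :=
      prefixNum_mono (l' := nodeLen s) (by omega) hs'
    omega

/-- An attack at a node on the true path answers a true value of the opponent, which exceeds the
stages of all earlier attacks of the same requirement. -/
theorem Attack.exists_value {s y l : ℕ} (h : Attack s y) (hl : stageIdx s = trueIdx l) :
    ∃ v ∈ eval (charFn highSet) (ofNatCode l.unpair.1) y, v < s ∧
      ∀ s' < s, ∀ y', Attack s' y' → stageIdx s' = trueIdx l → s' ≤ v := by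
  obtain ⟨-, v, hv, h1, h2⟩ := h.lt_and_beats
  refine ⟨v, ?_, hv, fun s' hs' y' h' hl' => 
    h1 (s', y') (mem_attacks.2 ⟨hs', h'⟩) (hl'.trans hl.symm)⟩
  have heq : charStr (enumStage (attacks s) s) s = charStr highSet s := by
    refine charStr_congr fun k hk => mem_setStage_iff_of_attack h ?_ hk
    rw [nodeStart_eq hl, nodeLen_eq hl, pathNum_startStage]
    exact fun u hu => truePath_le_pathNum hu
  rw [heq, nodeLen_eq hl] at h2
  exact h2.charStr_sound

/-- A second attack with the same argument would need a larger value of the opponent there. -/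
theorem Attack.arg_ne {s s' y y' l : ℕ} (h : Attack s y) (hl : stageIdx s = trueIdx l)
    (h' : Attack s' y') (hl' : stageIdx s' = trueIdx l) (hs : s < s') : y ≠ y' := by
  rintro rfl
  obtain ⟨v, hv, h1, -⟩ := h.exists_value hl
  obtain ⟨v', hv', -, h2⟩ := h'.exists_value hl'
  have := h2 s hs y h hl
  have := Part.mem_unique hv hv'
  omega

/-- The requirements on the true path make sure that the values of the opponent on small arguments
are exceeded by the stage of an attack. -/
theorem exists_attack_gt {l z v : ℕ} (hz : z < 2 ^ (trueIdx l + 1))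
    (hv : v ∈ eval (charFn highSet) (ofNatCode l.unpair.1) z) :
    ∃ s y, Attack s y ∧ stageIdx s = trueIdx l ∧ v < s := by
  by_contra! hcon
  obtain ⟨ℓ, hℓ⟩ := eventually_bel_charStr hv
  obtain ⟨s, ⟨hact, hidx⟩, hbel, hs, hvs, hset⟩ := ((frequently_active l).and_eventually
    (hℓ.and ((eventually_ge_atTop ℓ).and ((eventually_gt_atTop v).and
      (eventually_mem_setStage_iff ℓ))))).exists
  obtain ⟨y, hy⟩ := exists_attack hact (hidx ▸ hz) ⟨v, hvs, fun p hp he =>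
    hcon p.1 p.2 (mem_attacks.1 hp).2 (he.trans hidx),
    by rw [nodeLen_eq hidx]; exact hbel _ s hs hset⟩
  exact absurd (hcon s y hy hidx) (by omega)

/-! ### The list of the arguments of the attacks of a requirement -/

/-- The arguments of the attacks made before stage `t` by the requirement with index `m`. -/
noncomputable def attackArgs (t m : ℕ) : List ℕ :=
  ((attacks t).filter fun p => stageIdx p.1 = m).map Prod.snd

theorem mem_attackArgs {t m y : ℕ} :
    y ∈ attackArgs t m ↔ ∃ s < t, Attack s y ∧ stageIdx s = m := by
  simp only [attackArgs, List.mem_map, List.mem_filter, decide_eq_true_eq, Prod.exists,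
    mem_attacks, and_assoc]
  exact ⟨fun ⟨s, _, h1, h2, h3, h⟩ => ⟨s, h1, h ▸ h2, h3⟩,
    fun ⟨s, h1, h2, h3⟩ => ⟨s, y, h1, h2, h3, rfl⟩⟩

theorem attackArgs_prefix {s t : ℕ} (h : s ≤ t) (m : ℕ) : attackArgs s m <+: attackArgs t m :=
  ((attacks_prefix h).filter _).map _

theorem attackArgs_succ (t m : ℕ) :
    attackArgs (t + 1) m = attackArgs t m ∨
    ∃ y, Attack t y ∧ stageIdx t = m ∧ attackArgs (t + 1) m = attackArgs t m ++ [y] := by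
  cases h : nextAttack (attacks t) t with
  | none => exact .inl (by simp [attackArgs, attacks, h])
  | some y =>
    by_cases hm : stageIdx t = m
    · exact .inr ⟨y, h, hm, by simp [attackArgs, attacks, h, hm]⟩
    · exact .inl (by simp [attackArgs, attacks, h, hm])

theorem Attack.length_attackArgs {s y m t : ℕ} (h : Attack s y) (hm : stageIdx s = m)
    (ht : t ≤ s) : (attackArgs t m).length < (attackArgs (s + 1) m).length := by
  have h1 : attackArgs (s + 1) m = attackArgs s m ++ [y] := by
    have : nextAttack (attacks s) s = some y := h
    simp [attackArgs, attacks, this, hm]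
  have h2 := (attackArgs_prefix ht m).length_le
  rw [h1, List.length_append, List.length_singleton]
  omega

theorem nodup_attackArgs (t l : ℕ) : (attackArgs t (trueIdx l)).Nodup := by
  induction t with
  | zero => exact List.nodup_nil
  | succ t ih =>
    rcases attackArgs_succ t (trueIdx l) with h | ⟨y, hy, hm, h⟩
    · rwa [h]
    · rw [h]
      refine ih.append (List.nodup_singleton y) ?_
      rw [List.disjoint_singleton]
      intro hmem
      obtain ⟨s, hs, hs1, hs2⟩ := mem_attackArgs.1 hmem
      exact hs1.arg_ne hs2 hy hm hs rfl

theorem lt_of_mem_attackArgs {t m y : ℕ} (h : y ∈ attackArgs t m) : y < 2 ^ (m + 1) := by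
  obtain ⟨s, -, hs, rfl⟩ := mem_attackArgs.1 h
  exact hs.lt_and_beats.1

theorem List.Nodup.length_le_of_forall_lt {L : List ℕ} {n : ℕ} (h : L.Nodup)
    (hL : ∀ x ∈ L, x < n) : L.length ≤ n := by
  simpa using (h.subperm fun x hx => List.mem_range.2 (hL x hx)).length_le

/-- A requirement on the true path makes finitely many attacks only. -/
theorem exists_length_attackArgs_le (l : ℕ) : ∃ T, ∀ t,
    (attackArgs t (trueIdx l)).length ≤ (attackArgs T (trueIdx l)).length := by
  have hb : BddAbove (Set.range fun t => (attackArgs t (trueIdx l)).length) := by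
    refine ⟨2 ^ (trueIdx l + 1), ?_⟩
    rintro _ ⟨t, rfl⟩
    exact (nodup_attackArgs t l).length_le_of_forall_lt fun x hx => lt_of_mem_attackArgs hx
  obtain ⟨T, hT⟩ := Nat.sSup_mem (Set.range_nonempty _) hb
  exact ⟨T, fun t => (le_csSup hb ⟨t, rfl⟩).trans_eq hT.symm⟩

/-- A stage at which all attacks of a requirement on the true path have been made is larger than
all values of the opponent on small arguments. -/
theorem lt_of_length_attackArgs {l z v t : ℕ}
    (ht : ∀ s, (attackArgs s (trueIdx l)).length ≤ (attackArgs t (trueIdx l)).length)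
    (hz : z < 2 ^ (trueIdx l + 1))
    (hv : v ∈ eval (charFn highSet) (ofNatCode l.unpair.1) z) : v < t := by
  obtain ⟨s, y, hs, hm, hvs⟩ := exists_attack_gt hz hv
  by_contra hle
  exact absurd (ht (s + 1)) (not_le.2 (hs.length_attackArgs hm (by omega)))

theorem primrec_attackArgs : Primrec₂ attackArgs := by
  have hR : PrimrecRel fun (p : ℕ × ℕ) (m : ℕ) => stageIdx p.1 = m :=
    Primrec.eq.comp (primrec_stageIdx.comp (Primrec.fst.comp Primrec.fst)) Primrec.snd
  refine (Primrec.list_map (hR.listFilter.comp (primrec_attacks.comp Primrec.fst) Primrec.snd)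
    (g := fun _ p => p.2) (Primrec.snd.comp Primrec.snd).to₂).of_eq fun p => ?_
  rfl

/-! ### Two functions that are not both pdominated -/

/-- The block number of `x` is `m`, that is, `2 ^ m ≤ x < 2 ^ (m + 1)`, and at stage `t` the
requirement with index `m` has made more than `x - 2 ^ m` attacks. -/
def CountsAttacks (x t : ℕ) : Prop :=
  ∃ m < x + 1, (2 ^ m ≤ x ∧ x < 2 ^ (m + 1)) ∧ x < (attackArgs t m).length + 2 ^ m

/-- The block number of `x` is `m` and at stage `t` the requirement with index `m` has attacked with
argument `x`; the position `i` of this attack among those with arguments in the block satisfies that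
more than `i + 2 ^ m` attacks have been made. -/
def CountsLateAttacks (x t : ℕ) : Prop :=
  ∃ m < x + 1, (2 ^ m ≤ x ∧ x < 2 ^ (m + 1)) ∧ x ∈ attackArgs t m ∧
    ((attackArgs t m).filter (2 ^ m ≤ ·)).idxOf x + 2 ^ m < (attackArgs t m).length

theorem primrec_two_pow : Primrec fun m => 2 ^ m :=
  (Primrec₂.unpaired'.1 Nat.Primrec.pow).comp (Primrec.const 2) Primrec.id

theorem primrecPred_countsAttacks :
    PrimrecPred fun p : ℕ × ℕ => CountsAttacks p.1 p.2 := by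
  refine PrimrecPred.exists_lt_of (R := fun p m => (2 ^ m ≤ p.1 ∧ p.1 < 2 ^ (m + 1)) ∧
    p.1 < (attackArgs p.2 m).length + 2 ^ m) ?_ (Primrec.succ.comp Primrec.fst)
  have h1 : Primrec fun q : (ℕ × ℕ) × ℕ => q.1.1 := Primrec.fst.comp Primrec.fst
  have hm : Primrec fun q : (ℕ × ℕ) × ℕ => 2 ^ q.2 := primrec_two_pow.comp Primrec.snd
  have hm' : Primrec fun q : (ℕ × ℕ) × ℕ => 2 ^ (q.2 + 1) :=
    primrec_two_pow.comp (Primrec.succ.comp Primrec.snd)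
  have hL : Primrec fun q : (ℕ × ℕ) × ℕ => attackArgs q.1.2 q.2 :=
    primrec_attackArgs.comp (Primrec.snd.comp Primrec.fst) Primrec.snd
  exact ((Primrec.nat_le.comp hm h1).and (Primrec.nat_lt.comp h1 hm')).and
    (Primrec.nat_lt.comp h1 (Primrec.nat_add.comp (Primrec.list_length.comp hL) hm))

theorem primrecPred_countsLateAttacks :
    PrimrecPred fun p : ℕ × ℕ => CountsLateAttacks p.1 p.2 := by
  refine PrimrecPred.exists_lt_of (R := fun p m => (2 ^ m ≤ p.1 ∧ p.1 < 2 ^ (m + 1)) ∧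
    p.1 ∈ attackArgs p.2 m ∧ ((attackArgs p.2 m).filter (2 ^ m ≤ ·)).idxOf p.1 + 2 ^ m <
      (attackArgs p.2 m).length) ?_ (Primrec.succ.comp Primrec.fst)
  have h1 : Primrec fun q : (ℕ × ℕ) × ℕ => q.1.1 := Primrec.fst.comp Primrec.fst
  have hm : Primrec fun q : (ℕ × ℕ) × ℕ => 2 ^ q.2 := primrec_two_pow.comp Primrec.snd
  have hm' : Primrec fun q : (ℕ × ℕ) × ℕ => 2 ^ (q.2 + 1) :=
    primrec_two_pow.comp (Primrec.succ.comp Primrec.snd)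
  have hL : Primrec fun q : (ℕ × ℕ) × ℕ => attackArgs q.1.2 q.2 :=
    primrec_attackArgs.comp (Primrec.snd.comp Primrec.fst) Primrec.snd
  have hR : PrimrecRel fun (y a : ℕ) => a ≤ y := Primrec.nat_le.comp Primrec.snd Primrec.fst
  have hmem : PrimrecPred fun q : (ℕ × ℕ) × ℕ => q.1.1 ∈ attackArgs q.1.2 q.2 :=
    (Primrec.nat_lt.comp (Primrec.list_idxOf.comp h1 hL) (Primrec.list_length.comp hL)).of_eq
      fun q => List.idxOf_lt_length_iff
  refine ((Primrec.nat_le.comp hm h1).and (Primrec.nat_lt.comp h1 hm')).and (hmem.and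
    (Primrec.nat_lt.comp (Primrec.nat_add.comp (Primrec.list_idxOf.comp h1 ?_) hm)
      (Primrec.list_length.comp hL)))
  exact hR.listFilter.comp hL hm

theorem eq_of_block {x m m' : ℕ} (h : 2 ^ m ≤ x ∧ x < 2 ^ (m + 1))
    (h' : 2 ^ m' ≤ x ∧ x < 2 ^ (m' + 1)) : m' = m := by
  have h1 := (Nat.pow_lt_pow_iff_right (a := 2) (by omega)).1 (h.1.trans_lt h'.2)
  have h2 := (Nat.pow_lt_pow_iff_right (a := 2) (by omega)).1 (h'.1.trans_lt h.2)
  omega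

theorem List.IsPrefix.idxOf_eq {L L' : List ℕ} {x : ℕ} (h : L <+: L') (hx : x ∈ L) :
    L'.idxOf x = L.idxOf x := by
  obtain ⟨M, rfl⟩ := h
  exact List.idxOf_append_of_mem hx

/-- In the block of a requirement on the true path that makes some attack there is an argument on
which one of the two counting functions is defined and can only count all the attacks: the last of
the `N` attacks is counted by `2 ^ m + (N - 1)`, if this number lies in the block; otherwise, as the
arguments are distinct, at least `N - 2 ^ m` of them lie in the block, and the one among these
which is in position `N - 1 - 2 ^ m` will do. -/
theorem exists_counts {l T : ℕ} (hne : attackArgs T (trueIdx l) ≠ []) :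
    ∃ x, (2 ^ trueIdx l ≤ x ∧ x < 2 ^ (trueIdx l + 1)) ∧
      ((CountsAttacks x T ∧ ∀ t, CountsAttacks x t →
        (attackArgs T (trueIdx l)).length ≤ (attackArgs t (trueIdx l)).length) ∨
      (CountsLateAttacks x T ∧ ∀ t, CountsLateAttacks x t →
        (attackArgs T (trueIdx l)).length ≤ (attackArgs t (trueIdx l)).length)) := by
  have hnd := nodup_attackArgs T l
  set m := trueIdx l with hm
  set L := attackArgs T m with hL
  have hpos : 0 < L.length := List.length_pos_iff.2 hne
  have hpow : 2 ^ (m + 1) = 2 * 2 ^ m := by rw [pow_succ, mul_comm]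
  have hlt : m < 2 ^ m := Nat.lt_two_pow_self
  rcases le_or_gt L.length (2 ^ m) with hle | hgt
  · have hx : 2 ^ m ≤ 2 ^ m + (L.length - 1) ∧ 2 ^ m + (L.length - 1) < 2 ^ (m + 1) := by omega
    refine ⟨2 ^ m + (L.length - 1), hx, .inl ⟨⟨m, by omega, hx, by rw [← hL]; omega⟩, ?_⟩⟩
    rintro t ⟨m', -, hx', hc⟩
    obtain rfl := eq_of_block hx hx'
    omega
  · set F := L.filter (2 ^ m ≤ ·) with hF
    have hFlen : L.length ≤ F.length + 2 ^ m := by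
      have h1 : (L.filter fun y => !decide (2 ^ m ≤ y)).length ≤ 2 ^ m := by
        refine (hnd.filter _).length_le_of_forall_lt fun x hx => ?_
        simpa using (List.mem_filter.1 hx).2
      have h2 := List.length_eq_length_filter_add (l := L) (fun y => decide (2 ^ m ≤ y))
      rw [← hF] at h2
      omega
    have hi : L.length - 1 - 2 ^ m < F.length := by omega
    set x := F[L.length - 1 - 2 ^ m] with hxdef
    have hxF : x ∈ F := List.getElem_mem hi
    have hxL : x ∈ L := (List.mem_filter.1 hxF).1
    have hidx : F.idxOf x = L.length - 1 - 2 ^ m := (hnd.filter _).idxOf_getElem _ hi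
    have hx : 2 ^ m ≤ x ∧ x < 2 ^ (m + 1) :=
      ⟨by simpa using (List.mem_filter.1 hxF).2, lt_of_mem_attackArgs hxL⟩
    refine ⟨x, hx, .inr ⟨⟨m, by omega, hx, hxL, ?_⟩, ?_⟩⟩
    · rw [← hL, ← hF, hidx]; omega
    · rintro t ⟨m', -, hx', hmem, hc⟩
      obtain rfl := eq_of_block hx hx'
      have hxF' : x ∈ (attackArgs t m).filter (2 ^ m ≤ ·) :=
        List.mem_filter.2 ⟨hmem, by simpa using hx.1⟩
      have hpre : ((attackArgs t m).filter (2 ^ m ≤ ·)).idxOf x = F.idxOf x := by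
        rcases le_total t T with h | h
        · exact (((attackArgs_prefix h m).filter _).idxOf_eq hxF').symm
        · exact ((attackArgs_prefix h m).filter _).idxOf_eq hxF
      rw [hpre, hidx] at hc
      omega

theorem not_isPDominant_highSet : ¬ IsPDominant highSet := by
  rintro ⟨ψ, hψ, hdom⟩
  obtain ⟨c, rfl⟩ := exists_code.1 hψ
  obtain ⟨φ₁, hφ₁, hφ₁P, hφ₁D⟩ := exists_partrec_search primrecPred_countsAttacks
  obtain ⟨φ₂, hφ₂, hφ₂P, hφ₂D⟩ := exists_partrec_search primrecPred_countsLateAttacks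
  -- A function that pdominates a total function has some value.
  obtain ⟨z, v, hv⟩ : ∃ z v, v ∈ eval (charFn highSet) c z := by
    by_contra! hcon
    refine Set.infinite_univ ((hdom _ (Nat.Partrec.of_primrec Nat.Primrec.zero)).subset
      fun x _ => ⟨trivial, ?_⟩)
    rintro ⟨y, hy, -⟩
    exact hcon y _ (Part.get_mem hy)
  obtain ⟨B, hB⟩ := ((hdom φ₁ hφ₁).union (hdom φ₂ hφ₂)).bddAbove
  obtain ⟨l, hl, hlB, hlz⟩ : ∃ l : ℕ, l.unpair.1 = encodeCode c ∧ B < l ∧ z < l := by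
    refine ⟨Nat.pair (encodeCode c) (B + z + 1), by simp, ?_, ?_⟩ <;>
      have := Nat.right_le_pair (encodeCode c) (B + z + 1) <;> omega
  have hcl : ofNatCode l.unpair.1 = c := by rw [hl, ofNatCode_encodeCode]
  have hlm : l ≤ trueIdx l := Nat.left_le_pair _ _
  have hpow : trueIdx l < 2 ^ trueIdx l := Nat.lt_two_pow_self
  have hpow' : 2 ^ (trueIdx l + 1) = 2 * 2 ^ trueIdx l := by rw [pow_succ, mul_comm]
  obtain ⟨T, hT⟩ := exists_length_attackArgs_le l
  have hne : attackArgs T (trueIdx l) ≠ [] := by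
    obtain ⟨s, y, hs, hm, -⟩ :=
      exists_attack_gt (l := l) (z := z) (v := v) (by omega) (by rwa [hcl])
    have h1 := hs.length_attackArgs hm le_rfl
    have h2 := hT (s + 1)
    exact List.length_pos_iff.1 (by omega)
  obtain ⟨x, hx, hxT⟩ := exists_counts hne
  have hbad {φ : ℕ →. ℕ} {P : ℕ → Prop} (hD : (φ x).Dom) (hP : ∀ t ∈ φ x, P t)
      (hlen : ∀ t, P t →
        (attackArgs T (trueIdx l)).length ≤ (attackArgs t (trueIdx l)).length) :
      ∃ hx : (φ x).Dom, ¬ ∃ y, ∃ hy : (eval (charFn highSet) c y).Dom, y ≤ x ∧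
        (φ x).get hx < (eval (charFn highSet) c y).get hy := by
    refine ⟨hD, ?_⟩
    rintro ⟨y, hy, hyx, hlt⟩
    refine lt_asymm hlt (lt_of_length_attackArgs (l := l) (z := y) (fun s => ?_) (by omega) ?_)
    · exact (hT s).trans (hlen _ (hP _ (Part.get_mem hD)))
    · rw [hcl]; exact Part.get_mem hy
  have : x ≤ B := hB <| hxT.imp
    (fun h => hbad (hφ₁D _ _ h.1) (hφ₁P x) h.2) (fun h => hbad (hφ₂D _ _ h.1) (hφ₂P x) h.2)
  omega

/-! ### Highness -/

theorem mem_iff_of_prefixNum_eq {B C : Set ℕ} {i : ℕ}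
    (h : prefixNum B (i + 1) = prefixNum C (i + 1)) : i ∈ B ↔ i ∈ C := by
  have hB := charFn_le_one B i
  have hC := charFn_le_one C i
  have h' : charFn B i = charFn C i := by simp only [prefixNum] at h; omega
  by_cases h1 : i ∈ B <;> by_cases h2 : i ∈ C <;> simp_all [charFn]

/-- Late attacks at a node on the true path are made by the requirement that is never given up. -/
theorem stageIdx_eq_trueIdx {s : ℕ} (h : Active s) (hs : startStage (nodeLen s) ≤ s)
    (hp : pathNum s (nodeLen s) = truePath (nodeLen s)) : stageIdx s = trueIdx (nodeLen s) := by
  obtain ⟨h1, h2, h3, h4⟩ := h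
  rw [hp] at h2
  rw [← h2] at h3 h4
  suffices nodeStart s = startStage (nodeLen s) by
    rw [trueIdx, ← this, nodeLen, nodeStart, Nat.pair_unpair]
  refine le_antisymm (not_lt.1 fun hlt => ?_) (not_lt.1 fun hlt => ?_)
  · obtain ⟨u, -, hu, hu'⟩ := h4 _ hlt (pathNum_startStage _)
    exact absurd (truePath_le_pathNum hu.le) (by omega)
  · obtain ⟨u, hu, hu', hu''⟩ := exists_lt_of_lt_startStage hlt h2.symm
    exact absurd (h3 u (by omega) hu'.le) (by omega)

theorem eventually_not_attack (l : ℕ) : ∀ᶠ s in atTop, ∀ y, Attack s y → nodeLen s = l →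
    pathNum s l ≠ truePath l := by
  obtain ⟨T, hT⟩ := exists_length_attackArgs_le l
  filter_upwards [eventually_ge_atTop T, eventually_ge_atTop (startStage l)] with s h1 h2 y hy hl hp
  subst hl
  have hlt := hy.length_attackArgs (stageIdx_eq_trueIdx hy.active h2 hp) h1
  exact absurd (hT (s + 1)) (not_le.2 hlt)

theorem mem_jump_iff {i : ℕ} :
    i ∈ turingJump haltingSet ↔ ∃ s, ∀ t ≥ s, i ∈ stageGuess t := by
  refine ⟨fun h => eventually_atTop.1 (eventually_mem_stageGuess h), fun ⟨s, hs⟩ => ?_⟩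
  obtain ⟨t, ht, hp, -⟩ := frequently_atTop.1 (frequently_pathNum_eq (i + 1) 0) s
  exact (mem_iff_of_prefixNum_eq hp).1 (hs t ht)

/-- Stage `s` is a proof that `i` is not in the jump of the halting problem: its guess says so, and
at no later stage `t` is the guess at `t` to the left of it, or to the right of it with the
corresponding marker not being enumerated. -/
def Refutes (s i : ℕ) : Prop :=
  i ∉ stageGuess s ∧ ∀ t ≥ s, pathNum s (i + 1) ≤ pathNum t (i + 1) ∧
    ∀ j ≤ i, pathNum t j = pathNum s j → pathNum s (j + 1) < pathNum t (j + 1) →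
      Nat.pair j t + 2 ∈ highSet

/-- A late stage at which the guess is right refutes `i`: attacks of requirements on the true path
have come to an end, and so nothing prevents the markers of wrong guesses to the right of the true
path from being enumerated when the guess is right again. -/
theorem exists_refutes {i : ℕ} (hi : i ∉ turingJump haltingSet) : ∃ s, Refutes s i := by
  have h : ∀ᶠ s in atTop, ∀ l ∈ Set.Iic i, ∀ y, Attack s y → nodeLen s = l →
      pathNum s l ≠ truePath l :=
    (eventually_all_finite (Set.finite_Iic i)).2 fun l _ => eventually_not_attack l
  obtain ⟨S, hS⟩ := eventually_atTop.1 h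
  obtain ⟨s, ⟨hs, -⟩, hSs, hrs⟩ := ((frequently_pathNum_eq (i + 1) 0).and_eventually
    ((eventually_ge_atTop S).and (eventually_ge_atTop (startStage (i + 1))))).exists
  have hs' {j : ℕ} (hj : j ≤ i + 1) : pathNum s j = truePath j :=
    le_antisymm (prefixNum_mono hj hs.le) (prefixNum_mono hj hs.ge)
  refine ⟨s, fun h => hi ((mem_iff_of_prefixNum_eq hs).1 h), fun t ht => ⟨?_, fun j hj h1 h2 => ?_⟩⟩
  · rw [hs]; exact truePath_le_pathNum (hrs.trans ht)
  · rw [hs' (by omega)] at h1 h2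
    obtain ⟨s', hts', hp, -⟩ := frequently_atTop.1 (frequently_pathNum_eq (j + 1) 0) (t + 1)
    refine marker_mem_highSet.2 ⟨s', hts', hp ▸ h2, ?_⟩
    rintro ⟨p, y⟩ hpy ⟨h3, h4, h5, h6⟩
    have h7 : pathNum t (nodeLen p) = truePath (nodeLen p) :=
      le_antisymm (prefixNum_mono h5 h1.le) (prefixNum_mono h5 h1.ge)
    exact hS p (by omega) (nodeLen p) (h5.trans hj) y (mem_attacks.1 hpy).2 rfl (h6.trans h7)

/-- If the guess at `s` differed from the true path, say first at bit `j`, then it would lie to the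
left of it there. At a late stage `t` with the right guess a marker would then have to be enumerated,
but this requires that a later guess lies to the left of the true path. -/
theorem Refutes.notMem {s i : ℕ} (h : Refutes s i) : i ∉ turingJump haltingSet := by
  obtain ⟨hi, h⟩ := h
  have key : ∀ j ≤ i + 1, pathNum s j = truePath j := by
    intro j
    induction j with
    | zero => exact fun _ => rfl
    | succ j ih =>
      intro hj
      have hle : pathNum s (j + 1) ≤ truePath (j + 1) := by
        obtain ⟨t, ht, hp, -⟩ := frequently_atTop.1 (frequently_pathNum_eq (i + 1) 0) s
        exact prefixNum_mono hj ((h t ht).1.trans hp.le)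
      refine hle.eq_of_not_lt fun hlt => ?_
      obtain ⟨t, ht, hp, -⟩ := frequently_atTop.1 (frequently_pathNum_eq (j + 1) 0)
        (max s (startStage (j + 1)))
      have hpj : pathNum t j = truePath j :=
        le_antisymm (prefixNum_mono j.le_succ hp.le) (prefixNum_mono j.le_succ hp.ge)
      obtain ⟨s', hts', hlt', -⟩ := marker_mem_highSet.1 <|
        (h t (le_trans (le_max_left _ _) ht)).2 j (by omega) (hpj.trans (ih (by omega)).symm)
          (hp ▸ hlt)
      have := truePath_le_pathNum (((le_max_right _ _).trans ht).trans hts'.le)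
      omega
  exact fun hc => hi ((mem_iff_of_prefixNum_eq (key (i + 1) le_rfl)).2 hc)

/-! ### Limit computations from a jump -/

namespace OracleCode

/-- The program with constant value `n`. -/
def const : ℕ → OracleCode
  | 0 => zero
  | n + 1 => comp succ (const n)

theorem eval_const (g : ℕ → ℕ) (n x : ℕ) : eval g (const n) x = Part.some n := by
  induction n with
  | zero => rfl
  | succ n ih =>
    change ((eval g (const n) x).bind fun a => eval g succ a) = _
    rw [ih, Part.bind_some]; rfl

theorem primrec_encodeCode_const : Primrec fun n => encodeCode (const n) := by
  refine (Primrec.nat_rec₁ (f := fun _ r => 2 * (2 * Nat.pair 1 r + 1) + 5) 0 ?_).of_eq fun n => ?_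
  · exact Primrec.nat_add.comp (Primrec.nat_mul.comp (Primrec.const 2) (Primrec.succ.comp
      (Primrec.nat_mul.comp (Primrec.const 2) (Primrec₂.natPair.comp (Primrec.const 1)
        Primrec.snd)))) (Primrec.const 5)
  · induction n with
    | zero => rfl
    | succ n ih => simp only [const, encodeCode]; rw [← ih]

end OracleCode

theorem recursiveIn_search {k f : ℕ → ℕ} (hf : Primrec f) :
    Nat.RecursiveIn {(↑k : ℕ →. ℕ)} fun a =>
      Nat.rfind fun n => Part.some (decide (k (f (Nat.pair a n)) = 0)) := by
  refine (Nat.RecursiveIn.rfind <| (Nat.RecursiveIn.oracle (O := {(↑k : ℕ →. ℕ)}) _ rfl).comp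
    (Nat.Primrec.recursiveIn (Primrec.nat_iff.1 hf))).of_eq fun a => ?_
  refine congrArg Nat.rfind (funext fun n => ?_)
  change Part.map _ ((Part.some (f (Nat.pair a n))).bind fun b => Part.some (k b)) = _
  rw [Part.bind_some, Part.map_some]

/-- Existential questions about `A` are reducible to the jump of `A`. -/
theorem exists_primrec_mem_turingJump (A : Set ℕ) {h : ℕ → ℕ → ℕ} (hh : Primrec₂ h) :
    ∃ q : ℕ → ℕ, Primrec q ∧ ∀ p, q p ∈ turingJump A ↔ ∃ w, h p w ∉ A := by
  obtain ⟨c, hc⟩ := exists_code.1 <| recursiveIn_search (k := charFn A)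
    (f := fun n => h n.unpair.1 n.unpair.2)
    (hh.comp (Primrec.fst.comp Primrec.unpair) (Primrec.snd.comp Primrec.unpair))
  refine ⟨fun p => encodeCode (comp c (const p)), ?_, fun p => ?_⟩
  · exact Primrec.nat_add.comp (Primrec.nat_mul.comp (Primrec.const 2) (Primrec.succ.comp
      (Primrec.nat_mul.comp (Primrec.const 2) (Primrec₂.natPair.comp (Primrec.const _)
        primrec_encodeCode_const)))) (Primrec.const 5)
  · change (eval (charFn A) (ofNatCode (encodeCode (comp c (const p)))) _).Dom ↔ _
    rw [ofNatCode_encodeCode]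
    change ((eval (charFn A) (const p) _).bind fun a => eval (charFn A) c a).Dom ↔ _
    rw [eval_const, Part.bind_some, hc]
    refine Nat.rfind_dom'.trans (exists_congr fun w => ?_)
    by_cases hw : h p w ∈ A <;> simp [hw, charFn_of_mem, charFn_of_notMem]

/-- If, for every `i`, there is some `m` with `h (Nat.pair i m) w ∈ A` for all `w`, and the
parity of every such `m` is the value of the characteristic function of `B` at `i`, then `B` is
reducible to the jump of `A`. -/
theorem setTuringReducible_turingJump {A B : Set ℕ} {h : ℕ → ℕ → ℕ} (hh : Primrec₂ h)
    (hex : ∀ i, ∃ m, ∀ w, h (Nat.pair i m) w ∈ A)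
    (hval : ∀ i m, (∀ w, h (Nat.pair i m) w ∈ A) → m % 2 = charFn B i) :
    SetTuringReducible B (turingJump A) := by
  rw [SetTuringReducible, TuringReducible, RecursiveIn.iff_nat]
  obtain ⟨q, hq, hqA⟩ := exists_primrec_mem_turingJump A hh
  have hmod : Nat.Primrec fun m => m % 2 :=
    Primrec.nat_iff.1 (Primrec.nat_mod.comp Primrec.id (Primrec.const 2))
  have hq0 (p : ℕ) : charFn (turingJump A) (q p) = 0 ↔ ∀ w, h p w ∈ A := by
    by_cases hp : q p ∈ turingJump A
    · rw [charFn_of_mem hp]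
      simpa using (hqA p).1 hp
    · rw [charFn_of_notMem hp]
      simpa using mt (hqA p).2 hp
  refine ((Nat.Primrec.recursiveIn hmod).comp (recursiveIn_search hq)).of_eq fun i => ?_
  obtain ⟨m₀, hm₀⟩ := hex i
  obtain ⟨m, hm⟩ : ∃ m, m ∈ Nat.rfind fun n =>
      Part.some (decide (charFn (turingJump A) (q (Nat.pair i n)) = 0)) := by
    refine Part.dom_iff_mem.1 (Nat.rfind_dom'.2 ⟨m₀, ?_, fun _ => trivial⟩)
    simpa using (hq0 _).2 hm₀
  have hm' : ∀ w, h (Nat.pair i m) w ∈ A := (hq0 _).1 (by simpa using (Nat.mem_rfind.1 hm).1)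
  rw [Part.eq_some_iff.2 hm]
  change ((Part.some m).bind fun b => Part.some (b % 2)) = Part.some (charFn B i)
  rw [Part.bind_some, hval i m hm']

open Classical in
/-- The matrix of the description of the jump of the halting problem by universal questions about
the constructed set: `m` codes a claimed value `m % 2` of the characteristic function at `i` and a
stage `m / 2` which is to be a proof of it, and `t` and `j` are the stage and the bit at which the
proof is tested.  The elements `1` and `0` in and out of the set stand for success and failure. -/
noncomputable def jumpTest (i m t j : ℕ) : ℕ :=
  if m % 2 = 1 then if m / 2 ≤ t → i ∈ stageGuess t then 1 else 0
  else if i ∉ stageGuess (m / 2) ∧ (m / 2 ≤ t → pathNum (m / 2) (i + 1) ≤ pathNum t (i + 1)) then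
    if m / 2 ≤ t ∧ j ≤ i ∧ pathNum t j = pathNum (m / 2) j ∧
        pathNum (m / 2) (j + 1) < pathNum t (j + 1) then
      Nat.pair j t + 2
    else 1
  else 0

theorem forall_jumpTest_iff {i m : ℕ} : (∀ t j, jumpTest i m t j ∈ highSet) ↔
    if m % 2 = 1 then ∀ t ≥ m / 2, i ∈ stageGuess t else Refutes (m / 2) i := by
  simp only [jumpTest]
  split
  · refine forall_congr' fun t => ?_
    rw [forall_const]
    split
    · rename_i h; exact ⟨fun _ => h, fun _ => one_mem_highSet⟩
    · rename_i h; exact ⟨fun h' => absurd h' zero_notMem_highSet, fun h' => absurd h' h⟩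
  · constructor
    · intro h
      refine ⟨fun hi => ?_, fun t ht => ⟨?_, fun j hj h2 h3 => ?_⟩⟩
      · have := h 0 0
        rw [if_neg fun h => h.1 hi] at this
        exact zero_notMem_highSet this
      · by_contra hlt
        have := h t 0
        rw [if_neg fun h => hlt (h.2 ht)] at this
        exact zero_notMem_highSet this
      · have := h t j
        split at this
        · rwa [if_pos ⟨ht, hj, h2, h3⟩] at this
        · exact absurd this zero_notMem_highSet
    · rintro ⟨hi, h⟩ t j
      rw [if_pos ⟨hi, fun ht => (h t ht).1⟩]
      split
      · rename_i hc; exact (h t hc.1).2 j hc.2.1 hc.2.2.1 hc.2.2.2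
      · exact one_mem_highSet

theorem primrec_jumpTest : Primrec₂ fun p w : ℕ =>
    jumpTest p.unpair.1 p.unpair.2 w.unpair.1 w.unpair.2 := by
  classical
  have hN {f g : ℕ × ℕ → ℕ} (hf : Primrec f) (hg : Primrec g) :
      Primrec fun a => pathNum (f a) (g a) := primrec_pathNum.comp hf hg
  have hG {f g : ℕ × ℕ → ℕ} (hf : Primrec f) (hg : Primrec g) :
      PrimrecPred fun a => g a ∈ stageGuess (f a) := primrecPred_stageGuess.comp (hf.pair hg)
  have hi : Primrec fun a : ℕ × ℕ => a.1.unpair.1 :=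
    Primrec.fst.comp (Primrec.unpair.comp Primrec.fst)
  have hm : Primrec fun a : ℕ × ℕ => a.1.unpair.2 :=
    Primrec.snd.comp (Primrec.unpair.comp Primrec.fst)
  have hs : Primrec fun a : ℕ × ℕ => a.1.unpair.2 / 2 := Primrec.nat_div.comp hm (Primrec.const 2)
  have ht : Primrec fun a : ℕ × ℕ => a.2.unpair.1 :=
    Primrec.fst.comp (Primrec.unpair.comp Primrec.snd)
  have hj : Primrec fun a : ℕ × ℕ => a.2.unpair.2 :=
    Primrec.snd.comp (Primrec.unpair.comp Primrec.snd)
  have hi' : Primrec fun a : ℕ × ℕ => a.1.unpair.1 + 1 := Primrec.succ.comp hi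
  have hj' : Primrec fun a : ℕ × ℕ => a.2.unpair.2 + 1 := Primrec.succ.comp hj
  have hst := Primrec.nat_le.comp hs ht
  have h1 : Primrec fun _ : ℕ × ℕ => 1 := Primrec.const 1
  have h0 : Primrec fun _ : ℕ × ℕ => 0 := Primrec.const 0
  refine (Primrec.ite (Primrec.eq.comp (Primrec.nat_mod.comp hm (Primrec.const 2)) h1)
    (Primrec.ite (hst.imp (hG ht hi)) h1 h0)
    (Primrec.ite ((hG hs hi).not.and (hst.imp (Primrec.nat_le.comp (hN hs hi') (hN ht hi'))))
      (Primrec.ite (hst.and <| (Primrec.nat_le.comp hj hi).and <|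
          (Primrec.eq.comp (hN ht hj) (hN hs hj)).and
            (Primrec.nat_lt.comp (hN hs hj') (hN ht hj')))
        (Primrec.nat_add.comp (Primrec₂.natPair.comp hj ht) (Primrec.const 2)) h1) h0)).of_eq ?_
  rintro ⟨p, w⟩
  rfl

theorem isHigh_highSet : IsHigh highSet := by
  have hiff (i m : ℕ) : (∀ w : ℕ, jumpTest (Nat.pair i m).unpair.1 (Nat.pair i m).unpair.2
      w.unpair.1 w.unpair.2 ∈ highSet) ↔
      if m % 2 = 1 then ∀ t ≥ m / 2, i ∈ stageGuess t else Refutes (m / 2) i := by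
    rw [← forall_jumpTest_iff, Nat.unpair_pair]
    exact ⟨fun h t j => by simpa using h (Nat.pair t j), fun h w => h _ _⟩
  refine setTuringReducible_turingJump primrec_jumpTest (fun i => ?_) fun i m hm => ?_
  · by_cases hi : i ∈ turingJump haltingSet
    · obtain ⟨s, hs⟩ := mem_jump_iff.1 hi
      refine ⟨2 * s + 1, (hiff _ _).2 ?_⟩
      rwa [if_pos (by omega), show (2 * s + 1) / 2 = s by omega]
    · obtain ⟨s, hs⟩ := exists_refutes hi
      refine ⟨2 * s, (hiff _ _).2 ?_⟩
      rwa [if_neg (by omega), show 2 * s / 2 = s by omega]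
  · rw [hiff] at hm
    split at hm
    · rw [charFn_of_mem (mem_jump_iff.2 ⟨_, hm⟩)]; assumption
    · rw [charFn_of_notMem hm.notMem]; omega

theorem theorem5p3 : ∃ A : Set ℕ, IsRE A ∧ IsHigh A ∧ ¬ IsPDominant A :=
  ⟨highSet, isRE_highSet, isHigh_highSet, not_isPDominant_highSet⟩
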